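/- **Model.** There are $n=4f+1$ servers ($f\ge 0$), at most $f$ of them Byzantine, and arbitrarily many clients, which fail only by crashing. The system is asynchronous; every channel is FIFO and the sender of a message is known to its receiver; a broadcast sends the message to all servers. Byzantine servers may send arbitrary messages at any time, except that they cannot forge the client messages that servers forward: they can send $\mathrm{Proposed}(T,k)$ only if the client of $T$ has sent $\mathrm{Propose}(T)$, and $\mathrm{Confirm}(T,t)$ only if that client has sent it. The ledger state is a map from keys to values. Every transaction $T$ has an identifier, taken from a linearly ordered set (the *canonical order*) and used for one call; a declared read set and a declared write set; and deterministic code that, from the values of the read set, computes a result and, for each key of the write set, a new value or the choice to leave it unchanged. Two transactions *conflict* if one may write a key that the other may read or write. For every $T$ there is a binary consensus instance that decides at most once, on an initial value proposed by a correct server; a correct participant may learn the decision at any later time. **The Byblos protocol.** *Client, for $T$.* Broadcast $\mathrm{Propose}(T)$ (the *invocation*). When $\mathrm{ProposeAck}(T,\cdot)$ has been received from at least $n-f$ servers, let $\hat t$ be $1$ plus the $(f+1)$-st largest of the $n$ received values, the value being $0$ for servers that have not answered, and broadcast $\mathrm{Confirm}(T,\hat t)$. When identical messages $\mathrm{ResolveAck}(T,\mathit{code},\mathit{result})$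 have been received from $f+1$ servers, return $\mathit{result}$ if $\mathit{code}=\mathrm{COMMIT}$ and $\bot$ otherwise (the *response*). *Correct server.* It starts with the initial ledger state, clock $0$, an empty log and all sets empty. It does the following. - On $\mathrm{Propose}(T)$ from a client: add $(T,\mathit{clock})$ to $\mathit{proposed}[\mathit{self}]$, send $\mathrm{Proposed}(T,\mathit{clock})$ to all servers and $\mathrm{ProposeAck}(T,\mathit{clock})$ to the client. On $\mathrm{Proposed}(T,k)$ from a server $s$: add $(T,k)$ to $\mathit{proposed}[s]$. - On $\mathrm{Confirm}(T,t)$ from a client or a server: set $\mathit{clock}:=\max(\mathit{clock},t)$; add $T$ to $\mathit{confirmed}[t]$; send $\mathrm{Confirm}(T,t)$ to all servers if it has not done so before; if the sender is a server, add it to $W[T]$; if $\mathit{pending}[t]=\emptyset$ and $|W[T]|=n-f$, set $\mathit{pending}[t]:=\bigcup_{s\in W[T]}\{T' : (T',k)\in\mathit{proposed}[s]\text{ for some }k\le t\}$ and start the timer of $t$; if $T$ is not yet being resolved, start resolving it with COMMIT. - To start resolving $T$ with a code: send $\mathrm{StartResolution}(T,\cdot,\mathit{code})$ to all servers and enter the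 consensus instance of $T$ with initial value $\mathit{code}$. When the server learns the decision, it adds $T$ to $\mathit{committed}$ (decision COMMIT) or to $\mathit{cancelled}$ (decision CANCEL). - On $\mathrm{StartResolution}(T,\cdot,\mathrm{COMMIT})$ from a server, or once such messages with code CANCEL have been received from $f+1$ servers: start resolving $T$ with that code, unless $T$ is already being resolved. - When the timer of $t$ expires (which may happen at any time after its start): start resolving with CANCEL transactions of $\mathit{pending}[t]$ that are not yet being resolved. - A transaction $T\in\mathit{committed}\cap\mathit{confirmed}[t]$ that is not in the log, with $\mathit{pending}[t]\ne\emptyset$, may be applied if every other $T'\in\mathit{pending}[t]$ does not conflict with $T$, or is in $\mathit{cancelled}$, or is in the log, or is known to be ordered after $T$ (that is, $T'\in\mathit{confirmed}[t']$ with $t<t'$, or $T'\in\mathit{confirmed}[t]$ and $T<T'$ in the canonical order). Then $T$ is appended to the log and executed on the local ledger state, and $\mathrm{ResolveAck}(T,\mathrm{COMMIT},\mathit{result})$ is sent to its client. A cancelled transaction that is not in the log may be appended to it, with $\mathrm{ResolveAck}(T,\mathrm{CANCEL},\bot)$ sent to its client. **Theorem (Linearizability).** In every execution, finite or infinite, the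 following hold. 1. The execution is linearizable, in a way consistent with the responses of the correct servers. That is, one can choose a set of transactions and assign to each $T$ in it a time, distinct for distinct transactions, and a response $r_T$ (a result or $\bot$) such that: the time is after the invocation of $T$; if $T$ has a response at its client, then $T$ is in the set, its time is before that response, and the response equals $r_T$; if a correct server sends a $\mathrm{ResolveAck}$ for $T$, then $T$ is in the set, its time is no later than that sending step, and $r_T$ is the result sent (or $\bot$ if the code is CANCEL); and if the transactions in the set are executed sequentially, from the initial state, in the order of their times, those with $r_T=\bot$ having no effect, then every other $T$ returns exactly $r_T$. 2. Any two $\mathrm{ResolveAck}$ messages for the same $T$ sent by correct servers carry the same code and the same result. 3. No transaction is ever in $\mathit{committed}$ at one correct server and in $\mathit{cancelled}$ at a correct server. 4. Suppose that messages sent by clients and correct servers to correct servers are eventually delivered, and that, whenever all correct servers enter a consensus instance and one of them learns its decision, all of them eventually do. Then all correct servers commit the same set of transactions: a transaction that enters $\mathit{committed}$ at one correct server eventually enters it at every correct server. -/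

import Mathlib

namespace Byblos

/-! ### Transactions on a key-value store -/

/-- A transaction declares the keys it may read and the keys it may write. Its (deterministic) code is
confined to this declaration: it gets the values of the declared read keys, and returns for every
declared write key either a new value or `none` (the key is left alone), together with a result. -/
structure Transaction (K V R : Type*) where
  readSet : Set K
  writeSet : Set K
  body : (readSet → V) → (writeSet → Option V) × R

open Classical in
/-- Executing a transaction on a store: the new store and the result. -/
noncomputable def Transaction.apply {K V R : Type*} (T : Transaction K V R) (σ : K → V) :
    (K → V) × R :=
  let out := T.body (fun k => σ k)
  (fun k => if h : k ∈ T.writeSet then (out.1 ⟨k, h⟩).getD (σ k) else σ k, out.2)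

/-- Two transactions conflict if one of them may write a key that the other one may access. -/
def Transaction.Conflict {K V R : Type*} (T T' : Transaction K V R) : Prop :=
  (∃ k ∈ T.writeSet, k ∈ T'.readSet ∪ T'.writeSet) ∨
    (∃ k ∈ T'.writeSet, k ∈ T.readSet ∪ T.writeSet)

/-- The data of a system: `Tx` are transaction identifiers (each is used for one call), `owner T` is the
client that issues `T`, `txn T` its code with its declaration, `init` the initial ledger state. -/
structure Ledger (Client Tx K V R : Type*) where
  owner : Tx → Client
  txn : Tx → Transaction K V R
  init : K → V

/-! ### Servers, messages, local states -/

/-- The `n = 4 f + 1` servers. -/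
abbrev Server (f : ℕ) := Fin (4 * f + 1)

/-- The quorum size `n - f`. -/
def quorum (f : ℕ) : ℕ := (4 * f + 1) - f

inductive Node (Client : Type*) (f : ℕ) where
  | client (c : Client)
  | server (s : Server f)

inductive Code where
  | commit
  | cancel

inductive Msg (Tx R : Type*) where
  | propose (T : Tx)
  | proposeAck (T : Tx) (k : ℕ)
  | proposed (T : Tx) (k : ℕ)
  | confirm (T : Tx) (t : ℕ)
  | startResolution (T : Tx) (t : Option ℕ) (code : Code)
  | resolveAck (T : Tx) (code : Code) (result : Option R)

/-- The transaction that a message is about. -/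
def Msg.tx {Tx R : Type*} : Msg Tx R → Tx
  | .propose T => T
  | .proposeAck T _ => T
  | .proposed T _ => T
  | .confirm T _ => T
  | .startResolution T _ _ => T
  | .resolveAck T _ _ => T

/-- What a node sends in one step: for every destination, the messages sent to it, in order. -/
abbrev Outbox (Client Tx R : Type*) (f : ℕ) := Node Client f → List (Msg Tx R)

/-- Send `m` to all servers. -/
def toServers {Client Tx R : Type*} {f : ℕ} (m : Msg Tx R) : Outbox Client Tx R f
  | .server _ => [m]
  | .client _ => []

open Classical in
/-- Send `m` to the client `c`. -/
noncomputable def toClient {Client Tx R : Type*} {f : ℕ} (c : Client) (m : Msg Tx R) :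
    Outbox Client Tx R f
  | .server _ => []
  | .client c' => if c' = c then [m] else []

/-- The local state of a server. `timer` is the set of timestamps whose timer has been started.
`resolving T = some code` means that `T` is in the set of transactions being resolved, and that the
server has entered the consensus instance of `T` with the initial value `code`.
`confirmSent` records which `Confirm` messages the server has sent to the servers. -/
structure ServerState (Tx K V : Type*) (f : ℕ) where
  store : K → V
  clock : ℕ
  proposed : Server f → Set (Tx × ℕ)
  pending : ℕ → Set Tx
  confirmed : ℕ → Set Tx
  committed : Set Tx
  cancelled : Set Tx
  resolving : Tx → Option Code
  log : List Tx
  timer : Set ℕ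
  confirmSent : Set (Tx × ℕ)
  confirmWitness : Tx → Finset (Server f)
  cancelWitness : Tx → Finset (Server f)

/-- The initial state of a server. -/
def ServerState.start {Tx K V : Type*} {f : ℕ} (σ₀ : K → V) : ServerState Tx K V f where
  store := σ₀
  clock := 0
  proposed := fun _ => ∅
  pending := fun _ => ∅
  confirmed := fun _ => ∅
  committed := ∅
  cancelled := ∅
  resolving := fun _ => none
  log := []
  timer := ∅
  confirmSent := ∅
  confirmWitness := fun _ => ∅
  cancelWitness := fun _ => ∅

/-- The stages of the call that a client makes for one transaction. -/
inductive Phase (R : Type*) where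
  | idle
  | proposing
  | confirming
  | done (answer : Option R)

/-- The local state of the call for one transaction. -/
structure Call (Tx R : Type*) (f : ℕ) where
  phase : Phase R
  received : Set (Server f × Msg Tx R)

/-! ### Server code -/

section ServerCode

variable {Client Tx K V R : Type*} [LinearOrder Tx] {f : ℕ}

/-- Fork the resolve thread: announce it and enter the consensus instance of `T` with value `code`. -/
def startResolve (st : ServerState Tx K V f) (T : Tx) (t : Option ℕ) (code : Code) :
    ServerState Tx K V f × Outbox Client Tx R f :=
  ({ st with resolving := Function.update st.resolving T (some code) },
    toServers (.startResolution T t code))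

/-- `Propose(T)` received by server `self` from client `c`. -/
noncomputable def onPropose (self : Server f) (st : ServerState Tx K V f) (c : Client) (T : Tx) :
    ServerState Tx K V f × Outbox Client Tx R f :=
  ({ st with proposed :=
      Function.update st.proposed self (insert (T, st.clock) (st.proposed self)) },
    fun d => toServers (.proposed T st.clock) d ++ toClient c (.proposeAck T st.clock) d)

/-- `Proposed(T, k)` received from server `q`. -/
def onProposed (st : ServerState Tx K V f) (q : Server f) (T : Tx) (k : ℕ) :
    ServerState Tx K V f × Outbox Client Tx R f :=
  ({ st with proposed := Function.update st.proposed q (insert (T, k) (st.proposed q)) },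
    fun _ => [])

open Classical in
/-- `Confirm(T, t)` received from the node `src`. -/
noncomputable def onConfirm (st : ServerState Tx K V f) (src : Node Client f) (T : Tx) (t : ℕ) :
    ServerState Tx K V f × Outbox Client Tx R f :=
  let forward : Outbox Client Tx R f :=
    if (T, t) ∈ st.confirmSent then fun _ => [] else toServers (.confirm T t)
  let W : Finset (Server f) :=
    match src with
    | .server q => insert q (st.confirmWitness T)
    | .client _ => st.confirmWitness T
  let st₁ : ServerState Tx K V f :=
    { st with
      clock := max st.clock t
      confirmed := Function.update st.confirmed t (insert T (st.confirmed t))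
      confirmSent := insert (T, t) st.confirmSent
      confirmWitness := Function.update st.confirmWitness T W }
  let st₂ : ServerState Tx K V f :=
    if st₁.pending t = ∅ ∧ W.card = quorum f then
      { st₁ with
        pending := Function.update st₁.pending t
          {T' | ∃ q ∈ W, ∃ k ≤ t, (T', k) ∈ st₁.proposed q}
        timer := insert t st₁.timer }
    else st₁
  if st₂.resolving T = none then
    let r : ServerState Tx K V f × Outbox Client Tx R f := startResolve st₂ T (some t) .commit
    (r.1, fun d => forward d ++ r.2 d)
  else (st₂, forward)

open Classical in
/-- `StartResolution(T, t, code)` received from server `q`. -/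
noncomputable def onStartResolution (st : ServerState Tx K V f) (q : Server f) (T : Tx)
    (t : Option ℕ) (code : Code) : ServerState Tx K V f × Outbox Client Tx R f :=
  if st.resolving T = none then
    match code with
    | .commit => startResolve st T t .commit
    | .cancel =>
      let W := insert q (st.cancelWitness T)
      let st₁ : ServerState Tx K V f :=
        { st with cancelWitness := Function.update st.cancelWitness T W }
      if f + 1 ≤ W.card then startResolve st₁ T none .cancel else (st₁, fun _ => [])
  else (st, fun _ => [])

/-- The reaction of the correct server `self` to a message. All other messages are ignored. -/
noncomputable def onMessage (self : Server f) (st : ServerState Tx K V f) (src : Node Client f)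
    (m : Msg Tx R) : ServerState Tx K V f × Outbox Client Tx R f :=
  match src, m with
  | .client c, .propose T => onPropose self st c T
  | .server q, .proposed T k => onProposed st q T k
  | src, .confirm T t => onConfirm st src T t
  | .server q, .startResolution T t code => onStartResolution st q T t code
  | _, _ => (st, fun _ => [])

/-- The predicate `OrderBefore(T, T')` at a server: both transactions are confirmed, and `T` precedes
`T'` by timestamp, ties being resolved by the canonical order on transactions. -/
def OrderBefore (st : ServerState Tx K V f) (T T' : Tx) : Prop :=
  ∃ t, T ∈ st.confirmed t ∧
    ((∃ t', T' ∈ st.confirmed t' ∧ t < t') ∨ (T' ∈ st.confirmed t ∧ T < T'))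

/-- The condition under which a server may apply the committed transaction `T`. -/
def Applicable (L : Ledger Client Tx K V R) (st : ServerState Tx K V f) (T : Tx) : Prop :=
  T ∉ st.log ∧ ∃ t, T ∈ st.committed ∩ st.confirmed t ∧ st.pending t ≠ ∅ ∧
    ∀ T' ∈ st.pending t, T' ≠ T →
      ¬ (L.txn T).Conflict (L.txn T') ∨ T' ∈ st.cancelled ∨ T' ∈ st.log ∨ OrderBefore st T T'

end ServerCode

/-! ### The distributed system -/

/-- A global configuration. `sent a b` is the list of all messages sent so far from `a` to `b`, of which
the first `rcvd a b` have been delivered. `decision T` is the decision of the consensus instance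
of `T`, if it has been reached. -/
structure Config (Client Tx K V R : Type*) (f : ℕ) where
  server : Server f → ServerState Tx K V f
  call : Tx → Call Tx R f
  crashed : Set Client
  sent : Node Client f → Node Client f → List (Msg Tx R)
  rcvd : Node Client f → Node Client f → ℕ
  decision : Tx → Option Code

/-- Invocations and responses at the clients; the response `none` is the failure indication. -/
inductive Event (Tx R : Type*) where
  | inv (T : Tx)
  | res (T : Tx) (answer : Option R)

/-- The answer carried by a `ResolveAck` message with the given code and result. -/
def answer {R : Type*} : Code → Option R → Option R
  | .commit, r => r
  | .cancel, _ => none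

section System

variable {Client Tx K V R : Type*} [LinearOrder Tx] {f : ℕ}

/-- The initial configuration. -/
def Config.start (L : Ledger Client Tx K V R) : Config Client Tx K V R f where
  server := fun _ => ServerState.start L.init
  call := fun _ => ⟨.idle, ∅⟩
  crashed := ∅
  sent := fun _ _ => []
  rcvd := fun _ _ => 0
  decision := fun _ => none

open Classical in
/-- Node `a` sends the messages `out`. -/
noncomputable def Config.send (C : Config Client Tx K V R f) (a : Node Client f)
    (out : Outbox Client Tx R f) : Config Client Tx K V R f :=
  { C with sent := fun a' b => if a' = a then C.sent a' b ++ out b else C.sent a' b }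

/-- Server `s` changes its state and sends messages. -/
noncomputable def Config.serverStep (C : Config Client Tx K V R f) (s : Server f)
    (r : ServerState Tx K V f × Outbox Client Tx R f) : Config Client Tx K V R f :=
  Config.send { C with server := Function.update C.server s r.1 } (.server s) r.2

open Classical in
/-- One more message from `a` to `b` counts as delivered. -/
noncomputable def Config.consume (C : Config Client Tx K V R f) (a b : Node Client f) :
    Config Client Tx K V R f :=
  { C with rcvd := fun a' b' => if a' = a ∧ b' = b then C.rcvd a' b' + 1 else C.rcvd a' b' }

/-- The call of `T` moves to phase `p`. -/
def Config.setPhase (C : Config Client Tx K V R f) (T : Tx) (p : Phase R) :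
    Config Client Tx K V R f :=
  { C with call := Function.update C.call T { C.call T with phase := p } }

/-- The call of `T` is waiting for messages. -/
def Call.Active (c : Call Tx R f) : Prop := c.phase = .proposing ∨ c.phase = .confirming

open Classical in
/-- Client `c` receives `m` from server `q`: it is recorded if it is about a running call of `c`. -/
noncomputable def Config.clientReceive (L : Ledger Client Tx K V R) (C : Config Client Tx K V R f)
    (c : Client) (q : Server f) (m : Msg Tx R) : Config Client Tx K V R f :=
  if L.owner m.tx = c ∧ (C.call m.tx).Active then
    { C with
      call := Function.update C.call m.tx
        { C.call m.tx with received := insert (q, m) (C.call m.tx).received } }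
  else C

/-- The client that owns `T` has sent (and signed) the message `m`. -/
def Signed (L : Ledger Client Tx K V R) (C : Config Client Tx K V R f) (T : Tx)
    (m : Msg Tx R) : Prop :=
  ∃ q : Server f, m ∈ C.sent (.client (L.owner T)) (.server q)

/-- Messages that a Byzantine server is able to send: it cannot forge the messages of clients that
servers forward; everything else is unrestricted. -/
def Forgeable (L : Ledger Client Tx K V R) (C : Config Client Tx K V R f) : Msg Tx R → Prop
  | .proposed T _ => Signed L C T (.propose T)
  | .confirm T t => Signed L C T (.confirm T t)
  | _ => True

open Classical in
/-- `v` is the `(j + 1)`-st largest among the values `ts q`, counted with multiplicity: fewer than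
`j + 1` of them exceed `v`, and at least `j + 1` of them are `v` or larger. -/
def IsNthLargest (ts : Server f → ℕ) (j v : ℕ) : Prop :=
  (Finset.univ.filter fun q => v < ts q).card ≤ j ∧
    j + 1 ≤ (Finset.univ.filter fun q => v ≤ ts q).card

open Classical in
/-- `ts` is the table of timestamps collected for `T` from the received acknowledgements: the value
from each of at least `n - f` servers, and `0` for the servers that have not answered. -/
def Collected (C : Config Client Tx K V R f) (T : Tx) (ts : Server f → ℕ) : Prop :=
  quorum f ≤ (Finset.univ.filter fun q : Server f =>
      ∃ k, (q, Msg.proposeAck T k) ∈ (C.call T).received).card ∧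
    ∀ q, ((∃ k, (q, Msg.proposeAck T k) ∈ (C.call T).received) →
        (q, Msg.proposeAck T (ts q)) ∈ (C.call T).received) ∧
      ((¬ ∃ k, (q, Msg.proposeAck T k) ∈ (C.call T).received) → ts q = 0)

/-- The steps of the system, `byz` being the set of Byzantine servers. Steps of clients and of correct
servers follow the protocol, at arbitrary speeds. The binary consensus protocol on the fate of
each transaction is an ideal one: it decides at most once (agreement), on the initial value of
some correct server that takes part (validity); correct participants learn the decision later. -/
inductive Step (L : Ledger Client Tx K V R) (byz : Finset (Server f)) :
    Config Client Tx K V R f → Option (Event Tx R) → Config Client Tx K V R f → Prop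
  /-- Nothing happens. -/
  | stutter (C) : Step L byz C none C
  /-- A client crashes. -/
  | crash (C) (c : Client) : Step L byz C none { C with crashed := insert c C.crashed }
  /-- A client starts the call of `T` and broadcasts `Propose(T)`. -/
  | invoke (C) (T : Tx) (alive : L.owner T ∉ C.crashed) (idle : (C.call T).phase = .idle) :
      Step L byz C (some (.inv T))
        ((C.setPhase T .proposing).send (.client (L.owner T)) (toServers (.propose T)))
  /-- A client with enough acknowledgements chooses the timestamp and broadcasts `Confirm`. -/
  | confirm (C) (T : Tx) (ts : Server f → ℕ) (v : ℕ) (alive : L.owner T ∉ C.crashed)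
      (phase : (C.call T).phase = .proposing) (acks : Collected C T ts)
      (choice : IsNthLargest ts f v) :
      Step L byz C none
        ((C.setPhase T .confirming).send (.client (L.owner T)) (toServers (.confirm T (v + 1))))
  /-- A client with `f + 1` identical outcomes returns. -/
  | respond (C) (T : Tx) (code : Code) (r : Option R) (A : Finset (Server f))
      (alive : L.owner T ∉ C.crashed) (phase : (C.call T).phase = .confirming)
      (enough : f + 1 ≤ A.card)
      (same : ∀ q ∈ A, (q, Msg.resolveAck T code r) ∈ (C.call T).received) :
      Step L byz C (some (.res T (answer code r))) (C.setPhase T (.done (answer code r)))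
  /-- The next message from `a` is delivered to a correct server. -/
  | deliverServer (C) (a : Node Client f) (s : Server f) (m : Msg Tx R) (correct : s ∉ byz)
      (next : (C.sent a (.server s))[C.rcvd a (.server s)]? = some m) :
      Step L byz C none
        ((C.consume a (.server s)).serverStep s (onMessage s (C.server s) a m))
  /-- The next message from the server `q` is delivered to a client. -/
  | deliverClient (C) (q : Server f) (c : Client) (m : Msg Tx R) (alive : c ∉ C.crashed)
      (next : (C.sent (.server q) (.client c))[C.rcvd (.server q) (.client c)]? = some m) :
      Step L byz C none ((C.consume (.server q) (.client c)).clientReceive L c q m)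
  /-- A timer expires at a correct server, which starts to cancel an unresolved transaction. -/
  | timeout (C) (s : Server f) (t : ℕ) (T : Tx) (correct : s ∉ byz)
      (armed : t ∈ (C.server s).timer) (mem : T ∈ (C.server s).pending t)
      (fresh : (C.server s).resolving T = none) :
      Step L byz C none (C.serverStep s (startResolve (C.server s) T none .cancel))
  /-- The consensus instance of `T` reaches a decision. -/
  | decide (C) (T : Tx) (v : Code) (s : Server f) (undecided : C.decision T = none)
      (correct : s ∉ byz) (valid : (C.server s).resolving T = some v) :
      Step L byz C none { C with decision := Function.update C.decision T (some v) }
  /-- A correct participant of the consensus instance of `T` learns the decision to commit. -/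
  | learnCommit (C) (T : Tx) (s : Server f) (correct : s ∉ byz)
      (joined : (C.server s).resolving T ≠ none) (decided : C.decision T = some .commit) :
      Step L byz C none (C.serverStep s
        ({ C.server s with committed := insert T (C.server s).committed }, fun _ => []))
  /-- A correct participant of the consensus instance of `T` learns the decision to cancel. -/
  | learnCancel (C) (T : Tx) (s : Server f) (correct : s ∉ byz)
      (joined : (C.server s).resolving T ≠ none) (decided : C.decision T = some .cancel) :
      Step L byz C none (C.serverStep s
        ({ C.server s with cancelled := insert T (C.server s).cancelled }, fun _ => []))
  /-- A correct server applies a committed transaction and answers its client. -/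
  | applyCommit (C) (T : Tx) (s : Server f) (correct : s ∉ byz)
      (ready : Applicable L (C.server s) T) :
      Step L byz C none (C.serverStep s
        ({ C.server s with
            log := (C.server s).log ++ [T]
            store := ((L.txn T).apply (C.server s).store).1 },
          toClient (L.owner T)
            (.resolveAck T .commit (some ((L.txn T).apply (C.server s).store).2))))
  /-- A correct server logs a cancelled transaction and answers its client. -/
  | applyCancel (C) (T : Tx) (s : Server f) (correct : s ∉ byz)
      (mem : T ∈ (C.server s).cancelled) (fresh : T ∉ (C.server s).log) :
      Step L byz C none (C.serverStep s
        ({ C.server s with log := (C.server s).log ++ [T] },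
          toClient (L.owner T) (.resolveAck T .cancel none)))
  /-- A Byzantine server sends a message that it is able to produce. -/
  | byzantine (C) (s : Server f) (b : Node Client f) (m : Msg Tx R) (faulty : s ∈ byz)
      (able : Forgeable L C m) :
      Step L byz C none
        { C with
          sent := fun a' b' =>
            haveI := Classical.propDecidable (a' = .server s ∧ b' = b)
            if a' = .server s ∧ b' = b then C.sent a' b' ++ [m] else C.sent a' b' }

/-- An execution: `C i` is the configuration after `i` steps, and `ev i` the event, if any, at step `i`.
A finite execution is one that stutters from some point on. -/
structure Execution (L : Ledger Client Tx K V R) (byz : Finset (Server f)) where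
  C : ℕ → Config Client Tx K V R f
  ev : ℕ → Option (Event Tx R)
  start : C 0 = Config.start L
  step : ∀ i, Step L byz (C i) (ev i) (C (i + 1))

/-- The liveness of the two underlying services. -/
structure Execution.Fair {L : Ledger Client Tx K V R} {byz : Finset (Server f)}
    (ρ : Execution L byz) : Prop where
  /-- Messages from clients and from correct servers to correct servers are eventually delivered. -/
  delivery : ∀ (a : Node Client f) (s : Server f), (∀ q, a = .server q → q ∉ byz) → s ∉ byz →
    ∀ i k, k < ((ρ.C i).sent a (.server s)).length → ∃ j, k < (ρ.C j).rcvd a (.server s)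
  /-- If all correct servers take part in a consensus instance and one of them decides, then all of
  them eventually decide. -/
  consensus : ∀ T : Tx,
    (∀ s, s ∉ byz → ∃ i, ((ρ.C i).server s).resolving T ≠ none) →
    (∃ s, s ∉ byz ∧ ∃ i, T ∈ ((ρ.C i).server s).committed ∪ ((ρ.C i).server s).cancelled) →
    ∀ s, s ∉ byz → ∃ i, T ∈ ((ρ.C i).server s).committed ∪ ((ρ.C i).server s).cancelled

/-! ### Linearizability -/

/-- The sequential ledger: a transaction either succeeds, is applied to the state, and returns its
result, or fails with `none` and has no effect. -/
def SeqStep (L : Ledger Client Tx K V R) (σ : K → V) (T : Tx) : Option R → (K → V) → Prop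
  | some r, σ' => (L.txn T).apply σ = (σ', r)
  | none, σ' => σ' = σ

/-- `lin` is a linearization of the history `ev`: `lin i = some (T, r)` says that `T` takes effect
atomically, with response `r`, at time `i`. Each transaction takes effect at most once, only after
its invocation, and before its response, if there is one, and with that response; and the
sequence of transactions, in the order in which they take effect, is one of the sequential ledger. -/
structure IsLinearization (L : Ledger Client Tx K V R) (ev : ℕ → Option (Event Tx R))
    (lin : ℕ → Option (Tx × Option R)) : Prop where
  once : ∀ i j T r r', lin i = some (T, r) → lin j = some (T, r') → i = j
  after_inv : ∀ i T r, lin i = some (T, r) → ∃ j < i, ev j = some (.inv T)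
  before_res : ∀ k T r, ev k = some (.res T r) → ∃ i < k, lin i = some (T, r)
  legal : ∃ σ : ℕ → K → V, σ 0 = L.init ∧
    (∀ i, lin i = none → σ (i + 1) = σ i) ∧
    (∀ i T r, lin i = some (T, r) → SeqStep L (σ i) T r (σ (i + 1)))

end System

end Byblos

/-! The client of `T` sends a single timestamp, and Byzantine servers cannot forge it
(`stamp_unique`). So timestamps, with ties broken by identifiers, give one global order `Before` on
the timestamped transactions. The core is `lt_stamp`: if a correct server has a nonempty `pending t`
that lacks `T`, then any timestamp of `T` exceeds `t`. Two sets of `n - f` servers share at least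
`2f + 1` servers, hence `f + 1` correct ones that both sent this server a `Confirm` with timestamp
`t` and answered the client of `T`. If one of them had proposed `T` with a value `k < t`, monotone
clocks would place that message before its `Confirm`, and FIFO delivery would have put `T` into
`pending t`. So `f + 1` answers are at least `t`, and one plus the `(f + 1)`-st largest answer
exceeds `t`.

Consequently (`before_of_applicable`), a correct server applies `T` ahead of a conflicting `T'` that
has a timestamp and is decided COMMIT only if `T` is `Before` `T'`. Hence the committed part of each
correct log, and also the global list of committed transactions by first appearance in a correct
log, are `Orderly`. Such lists may permute transactions that do not conflict, but `Orderly.run_eq`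
shows that a transaction finds the same values on its keys in all of them. The linearization point
of a transaction is the first step in which a correct server logs it. Every acknowledgement by a
correct server then agrees with the sequential run of the global list, and among `f + 1` equal
acknowledgements one comes from a correct server.

Agreement on outcomes is inherited from consensus. For equality of the committed sets, a COMMIT
decision is the initial value of some correct server, whose announcement draws every correct server
into the instance; liveness of consensus does the rest. -/

namespace Byblos

/-! ### The message handlers of a server. -/

section Local

variable {Client Tx K V R : Type*} [LinearOrder Tx] {f : ℕ}

theorem onConfirm_fields (st : ServerState Tx K V f) (src : Node Client f) (T : Tx) (t : ℕ) :
    let st' := (onConfirm (R := R) st src T t).1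
    st'.store = st.store ∧ st'.log = st.log ∧ st'.committed = st.committed ∧
      st'.cancelled = st.cancelled ∧ st'.proposed = st.proposed ∧
      st'.cancelWitness = st.cancelWitness ∧ st'.clock = max st.clock t ∧
      st'.confirmed = Function.update st.confirmed t (insert T (st.confirmed t)) := by
  unfold onConfirm startResolve
  dsimp only
  split_ifs <;> simp

theorem onConfirm_resolving (st : ServerState Tx K V f) (src : Node Client f) (T T' : Tx) (t : ℕ) :
    (onConfirm (R := R) st src T t).1.resolving T' =
      if T' = T ∧ st.resolving T = none then some .commit else st.resolving T' := by
  unfold onConfirm startResolve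
  dsimp only
  split_ifs <;> simp_all

theorem onConfirm_out (st : ServerState Tx K V f) (src : Node Client f) (T : Tx) (t : ℕ)
    (d : Node Client f) (m : Msg Tx R) :
    m ∈ (onConfirm st src T t).2 d ↔ (∃ q, d = .server q) ∧
      (m = .confirm T t ∧ (T, t) ∉ st.confirmSent ∨
        m = .startResolution T (some t) .commit ∧ st.resolving T = none) := by
  unfold onConfirm startResolve
  dsimp only
  cases d <;> split_ifs <;> simp_all [toServers]

theorem onConfirm_confirmWitness (st : ServerState Tx K V f) (src : Node Client f) (T T' : Tx)
    (t : ℕ) (q : Server f) (h : q ∈ (onConfirm (R := R) st src T t).1.confirmWitness T') :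
    q ∈ st.confirmWitness T' ∨ src = .server q ∧ T' = T := by
  by_cases hT : T' = T
  · subst hT
    unfold onConfirm startResolve at h
    cases src <;> dsimp only at h <;> split_ifs at h <;> simp_all [eq_comm, or_comm]
  · unfold onConfirm startResolve at h
    dsimp only at h
    split_ifs at h <;> simp_all

/-- The emptiness clause matters: a set that was computed and came out empty may be computed again,
so stability of `pending t` can be claimed only once it is nonempty. -/
theorem onConfirm_pending (st : ServerState Tx K V f) (src : Node Client f) (T : Tx) (t t' : ℕ) :
    let st' := (onConfirm (R := R) st src T t).1
    st'.pending t' = st.pending t' ∨ t' = t ∧ st.pending t' = ∅ ∧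
      (st'.confirmWitness T).card = quorum f ∧
      st'.pending t' = {T' | ∃ q ∈ st'.confirmWitness T, ∃ k ≤ t, (T', k) ∈ st'.proposed q} := by
  by_cases ht : t' = t
  · subst ht
    unfold onConfirm startResolve
    dsimp only
    split_ifs <;> simp_all
  · left
    unfold onConfirm startResolve
    dsimp only
    split_ifs <;> simp_all

theorem onStartResolution_fields (st : ServerState Tx K V f) (q : Server f) (T : Tx)
    (t : Option ℕ) (code : Code) :
    let st' := (onStartResolution (Client := Client) (R := R) st q T t code).1
    st'.store = st.store ∧ st'.log = st.log ∧ st'.committed = st.committed ∧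
      st'.cancelled = st.cancelled ∧ st'.proposed = st.proposed ∧
      st'.confirmWitness = st.confirmWitness ∧ st'.clock = st.clock ∧
      st'.confirmed = st.confirmed ∧ st'.pending = st.pending := by
  unfold onStartResolution startResolve
  cases code <;> dsimp only <;> split_ifs <;> simp

theorem onStartResolution_cancelWitness (st : ServerState Tx K V f) (q q' : Server f) (T T' : Tx)
    (t : Option ℕ) (code : Code)
    (h : q' ∈ (onStartResolution (Client := Client) (R := R) st q T t code).1.cancelWitness T') :
    q' ∈ st.cancelWitness T' ∨ q' = q ∧ T' = T ∧ code = .cancel := by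
  by_cases hT : T' = T
  · subst hT
    unfold onStartResolution startResolve at h
    cases code <;> dsimp only at h <;> split_ifs at h <;> simp_all [or_comm]
  · unfold onStartResolution startResolve at h
    cases code <;> dsimp only at h <;> split_ifs at h <;> simp_all

/-- The bound in the last clause is what later traces a cancellation back to a correct server. -/
theorem onStartResolution_cases (st : ServerState Tx K V f) (q : Server f) (T : Tx)
    (t : Option ℕ) (code : Code) :
    let r := onStartResolution (Client := Client) (R := R) st q T t code
    (r.1.resolving = st.resolving ∧ r.2 = fun _ => []) ∧
        (code = .commit → st.resolving T ≠ none) ∨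
      st.resolving T = none ∧ r.1.resolving = Function.update st.resolving T (some code) ∧
        (∃ t', r.2 = toServers (.startResolution T t' code)) ∧
        (code = .cancel → f + 1 ≤ (r.1.cancelWitness T).card) := by
  unfold onStartResolution startResolve
  cases code <;> dsimp only <;> split_ifs <;> simp_all
  all_goals exact ⟨_, rfl⟩

/-! ### Single steps of the whole system. -/

/-- A step of the correct server `s` between the configurations `C` and `C'`, leading to the given
local state and sending the given messages. -/
inductive Effect (L : Ledger Client Tx K V R) (C C' : Config Client Tx K V R f) (s : Server f) :
    ServerState Tx K V f → Outbox Client Tx R f → Prop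
  | message (a : Node Client f) (m : Msg Tx R)
      (next : (C.sent a (.server s))[C.rcvd a (.server s)]? = some m)
      (consumed : C'.rcvd a (.server s) = C.rcvd a (.server s) + 1) :
      Effect L C C' s (onMessage s (C.server s) a m).1 (onMessage s (C.server s) a m).2
  | timeout (t : ℕ) (T : Tx) (mem : T ∈ (C.server s).pending t)
      (fresh : (C.server s).resolving T = none) :
      Effect L C C' s (startResolve (Client := Client) (R := R) (C.server s) T none .cancel).1
        (startResolve (C.server s) T none .cancel).2
  | learnCommit (T : Tx) (decided : C.decision T = some .commit)
      (joined : (C.server s).resolving T ≠ none) :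
      Effect L C C' s { C.server s with committed := insert T (C.server s).committed }
        (fun _ => [])
  | learnCancel (T : Tx) (decided : C.decision T = some .cancel)
      (joined : (C.server s).resolving T ≠ none) :
      Effect L C C' s { C.server s with cancelled := insert T (C.server s).cancelled }
        (fun _ => [])
  | applyCommit (T : Tx) (ready : Applicable L (C.server s) T) :
      Effect L C C' s
        { C.server s with
            log := (C.server s).log ++ [T]
            store := ((L.txn T).apply (C.server s).store).1 }
        (toClient (L.owner T)
            (.resolveAck T .commit (some ((L.txn T).apply (C.server s).store).2)))
  | applyCancel (T : Tx) (mem : T ∈ (C.server s).cancelled) (fresh : T ∉ (C.server s).log) :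
      Effect L C C' s { C.server s with log := (C.server s).log ++ [T] }
        (toClient (L.owner T) (.resolveAck T .cancel none))

variable {L : Ledger Client Tx K V R} {byz : Finset (Server f)}
  {C C' : Config Client Tx K V R f} {e : Option (Event Tx R)} {s : Server f}
  {st : ServerState Tx K V f} {out : Outbox Client Tx R f}

/-- Message number `p` from `a` to the server `s` is `m`, and it has been delivered. -/
def Delivered (C : Config Client Tx K V R f) (a : Node Client f) (s : Server f) (p : ℕ)
    (m : Msg Tx R) : Prop :=
  p < C.rcvd a (.server s) ∧ (C.sent a (.server s))[p]? = some m

/-- In a step, a correct server does nothing, or acts according to the protocol. -/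
theorem Step.correct (h : Step L byz C e C') (hs : s ∉ byz) :
    (C'.server s = C.server s ∧ ∀ b, C'.sent (.server s) b = C.sent (.server s) b) ∨
      ∃ out, Effect L C C' s (C'.server s) out ∧
        ∀ b, C'.sent (.server s) b = C.sent (.server s) b ++ out b := by
  cases h with
  | deliverServer a s' m correct next =>
    by_cases hss : s = s'
    · subst hss
      refine .inr ⟨(onMessage s (C.server s) a m).2, ?_⟩
      simpa [Config.serverStep, Config.send, Config.consume] using .message a m next (by simp)
    · left; simp [Config.serverStep, Config.send, Config.consume, hss]
  | timeout s' t T correct armed mem fresh =>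
    by_cases hss : s = s'
    · subst hss
      refine .inr ⟨(startResolve (C.server s) T none .cancel).2, ?_⟩
      simpa [Config.serverStep, Config.send] using .timeout t T mem fresh
    · left; simp [Config.serverStep, Config.send, hss]
  | learnCommit T s' correct joined decided =>
    by_cases hss : s = s'
    · subst hss
      refine .inr ⟨fun _ => [], ?_⟩
      simpa [Config.serverStep, Config.send] using .learnCommit T decided joined
    · left; simp [Config.serverStep, Config.send, hss]
  | learnCancel T s' correct joined decided =>
    by_cases hss : s = s'
    · subst hss
      refine .inr ⟨fun _ => [], ?_⟩
      simpa [Config.serverStep, Config.send] using .learnCancel T decided joined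
    · left; simp [Config.serverStep, Config.send, hss]
  | applyCommit T s' correct ready =>
    by_cases hss : s = s'
    · subst hss
      refine .inr ⟨toClient (L.owner T)
        (.resolveAck T .commit (some ((L.txn T).apply (C.server s).store).2)), ?_⟩
      simpa [Config.serverStep, Config.send] using .applyCommit T ready
    · left; simp [Config.serverStep, Config.send, hss]
  | applyCancel T s' correct mem fresh =>
    by_cases hss : s = s'
    · subst hss
      refine .inr ⟨toClient (L.owner T) (.resolveAck T .cancel none), ?_⟩
      simpa [Config.serverStep, Config.send] using .applyCancel T mem fresh
    · left; simp [Config.serverStep, Config.send, hss]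
  | byzantine s' b m faulty able =>
    have : s ≠ s' := by rintro rfl; exact hs faulty
    left; simp [this]
  | deliverClient q c m alive next =>
    left
    unfold Config.clientReceive
    split_ifs <;> simp [Config.consume]
  | _ => left; simp [Config.setPhase, Config.send]

theorem Step.sent_prefix (h : Step L byz C e C') (a b : Node Client f) :
    C.sent a b <+: C'.sent a b := by
  cases h with
  | deliverClient q c m alive next =>
    unfold Config.clientReceive
    split_ifs <;> simp [Config.consume]
  | _ => simp [Config.setPhase, Config.send, Config.serverStep, Config.consume] <;>
      split_ifs <;> simp

theorem Step.byzantine_sent (h : Step L byz C e C') (hs : s ∈ byz) {b : Node Client f}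
    {m : Msg Tx R} (hm : m ∈ C'.sent (.server s) b) :
    m ∈ C.sent (.server s) b ∨ Forgeable L C m := by
  cases h with
  | byzantine s' b' m' faulty able =>
    dsimp only at hm
    split_ifs at hm
    · simp only [List.mem_append, List.mem_singleton] at hm
      rcases hm with hm | rfl
      · exact .inl hm
      · exact .inr able
    · exact .inl hm
  | deliverClient q c m alive next =>
    unfold Config.clientReceive at hm
    split_ifs at hm <;> exact .inl hm
  | stutter | crash | decide | respond => exact .inl hm
  | invoke | confirm => exact .inl (by simpa [Config.setPhase, Config.send] using hm)
  | _ => left; grind [Config.send, Config.serverStep, Config.consume]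

/-- An invariant "this message has been delivered, so the receiver has processed it" follows by
induction from this dichotomy. The bound `hle` ensures that a position counted as delivered before
the step already held a message, which appending does not alter. -/
theorem Step.delivered (h : Step L byz C e C') {a : Node Client f} {p : ℕ}
    {m : Msg Tx R} (hle : C.rcvd a (.server s) ≤ (C.sent a (.server s)).length)
    (hd : Delivered C' a s p m) :
    Delivered C a s p m ∨ C'.server s = (onMessage s (C.server s) a m).1 := by
  obtain ⟨hp, hm⟩ := hd
  by_cases hpc : p < C.rcvd a (.server s)
  · refine .inl ⟨hpc, ?_⟩
    obtain ⟨l, hl⟩ := h.sent_prefix a (.server s)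
    rwa [← hl, List.getElem?_append_left (hpc.trans_le hle)] at hm
  · right
    have hpre := h.sent_prefix a (.server s)
    cases h with
    | deliverServer a' s' m' correct next =>
      have hab : a = a' ∧ s = s' := by
        by_contra hne
        apply hpc
        simpa [Config.serverStep, Config.send, Config.consume, hne] using hp
      obtain ⟨rfl, rfl⟩ := hab
      -- The position is not below the old counter but is below the new one, which is larger by one.
      have hp' : p = C.rcvd a (.server s) := by
        simp [Config.serverStep, Config.send, Config.consume] at hp
        omega
      subst hp'
      obtain ⟨l, hl⟩ := hpre
      have : m = m' := by
        rw [← hl, List.getElem?_append_left (List.getElem?_eq_some_iff.mp next).1, next] at hm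
        exact (Option.some_injective _ hm).symm
      subst this
      simp [Config.serverStep, Config.send, Config.consume]
    | deliverClient q c m alive next =>
      unfold Config.clientReceive at hp
      split_ifs at hp <;> simp [Config.consume] at hp <;> omega
    | _ => exact absurd hp hpc

theorem Step.rcvd_le (h : Step L byz C e C') {a b : Node Client f}
    (hle : C.rcvd a b ≤ (C.sent a b).length) : C'.rcvd a b ≤ (C'.sent a b).length := by
  refine le_trans ?_ (h.sent_prefix a b).length_le
  cases h with
  | deliverServer a' s' m' correct next =>
    have := (List.getElem?_eq_some_iff.mp next).1
    simp only [Config.serverStep, Config.send, Config.consume]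
    split_ifs with hab
    · obtain ⟨rfl, rfl⟩ := hab
      exact this
    · exact hle
  | deliverClient q c m alive next =>
    have := (List.getElem?_eq_some_iff.mp next).1
    unfold Config.clientReceive
    split_ifs <;> simp only [Config.consume] <;> split_ifs with hab <;> grind
  | _ => exact hle

theorem Step.rcvd_mono (h : Step L byz C e C') (a b : Node Client f) :
    C.rcvd a b ≤ C'.rcvd a b := by
  cases h with
  | deliverClient q c m alive next =>
    unfold Config.clientReceive
    split_ifs <;> simp only [Config.consume] <;> split_ifs <;> omega
  | deliverServer =>
    simp only [Config.serverStep, Config.send, Config.consume]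
    split_ifs <;> omega
  | _ => exact le_rfl

theorem Step.decision_mono (h : Step L byz C e C') {T : Tx} {v : Code}
    (hT : C.decision T = some v) : C'.decision T = some v := by
  cases h with
  | deliverClient q c m alive next =>
    unfold Config.clientReceive
    split_ifs <;> exact hT
  | decide T' v' s' undecided correct valid =>
    have : T ≠ T' := by rintro rfl; simp [hT] at undecided
    simpa [this] using hT
  | _ => exact hT

theorem Step.decision_valid (h : Step L byz C e C') {T : Tx} {v : Code}
    (hT : C'.decision T = some v) :
    C.decision T = some v ∨ ∃ s ∉ byz, (C.server s).resolving T = some v := by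
  cases h with
  | deliverClient q c m alive next =>
    unfold Config.clientReceive at hT
    split_ifs at hT <;> exact .inl hT
  | decide T' v' s' undecided correct valid =>
    by_cases hTT : T = T'
    · subst hTT
      simp at hT
      exact .inr ⟨s', correct, hT ▸ valid⟩
    · exact .inl (by simpa [hTT] using hT)
  | _ => exact .inl hT

theorem Step.phase_mono (h : Step L byz C e C') {T : Tx} (hT : (C.call T).phase ≠ .idle) :
    (C'.call T).phase ≠ .idle := by
  cases h with
  | deliverClient q c m alive next =>
    unfold Config.clientReceive
    split_ifs
    · by_cases hTm : T = m.tx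
      · subst hTm; simpa [Config.consume] using hT
      · simpa [Config.consume, hTm] using hT
    · exact hT
  | invoke T' | confirm T' | respond T' =>
    by_cases hTT : T = T' <;> simp_all [Config.setPhase, Config.send]
  | _ => exact hT

/-- The client of `T` has chosen a timestamp. -/
def Call.Chosen (c : Call Tx R f) : Prop := c.phase ≠ .idle ∧ c.phase ≠ .proposing

theorem Step.chosen_mono (h : Step L byz C e C') {T : Tx} (hT : (C.call T).Chosen) :
    (C'.call T).Chosen := by
  unfold Call.Chosen at *
  cases h with
  | deliverClient q c m alive next =>
    unfold Config.clientReceive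
    split_ifs
    · by_cases hTm : T = m.tx
      · subst hTm; simpa [Config.consume] using hT
      · simpa [Config.consume, hTm] using hT
    · exact hT
  | invoke T' | confirm T' | respond T' =>
    by_cases hTT : T = T' <;> simp_all [Config.setPhase, Config.send]
  | _ => exact hT

theorem Step.started (h : Step L byz C e C') {T : Tx} (hT : (C'.call T).phase ≠ .idle) :
    (C.call T).phase ≠ .idle ∨ e = some (.inv T) := by
  cases h with
  | deliverClient q c m alive next =>
    unfold Config.clientReceive at hT
    left
    split_ifs at hT
    · by_cases hTm : T = m.tx
      · subst hTm; simpa [Config.consume] using hT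
      · simpa [Config.consume, hTm] using hT
    · exact hT
  | invoke T' | confirm T' | respond T' =>
    by_cases hTT : T = T' <;> simp_all [Config.setPhase, Config.send]
  | _ => exact .inl hT

theorem Step.received (h : Step L byz C e C') {T : Tx} {q : Server f} {m : Msg Tx R}
    (hm : (q, m) ∈ (C'.call T).received) :
    (q, m) ∈ (C.call T).received ∨ m ∈ C.sent (.server q) (.client (L.owner T)) := by
  cases h with
  | deliverClient q' c m' alive next =>
    unfold Config.clientReceive at hm
    split_ifs at hm with hc
    · by_cases hTm : T = m'.tx
      · subst hTm
        simp only [Config.consume, Function.update_self, Set.mem_insert_iff, Prod.mk.injEq] at hm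
        rcases hm with ⟨rfl, rfl⟩ | hm
        · right
          rw [hc.1]
          exact List.mem_of_getElem? next
        · exact .inl hm
      · simp only [Function.update_of_ne hTm] at hm
        exact .inl hm
    · exact .inl hm
  | invoke T' | confirm T' | respond T' =>
    by_cases hTT : T = T' <;> simp_all [Config.setPhase, Config.send]
  | _ => exact .inl hm

/-- The last clause, on all channels from the client to servers at once, excludes different
timestamps being sent to different servers in one broadcast. -/
theorem Step.client_sent (h : Step L byz C e C') {c : Client} {b : Node Client f} {m : Msg Tx R}
    (hm : m ∈ C'.sent (.client c) b) :
    m ∈ C.sent (.client c) b ∨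
      (∃ T, m = .propose T ∧ c = L.owner T ∧ (C'.call T).phase ≠ .idle) ∨
      ∃ T v ts, m = .confirm T (v + 1) ∧ c = L.owner T ∧ (∃ q, b = .server q) ∧
        (C.call T).phase = .proposing ∧
        (C'.call T).Chosen ∧ Collected C T ts ∧ IsNthLargest ts f v ∧
        ∀ q, C'.sent (.client c) (.server q) = C.sent (.client c) (.server q) ++ [m] := by
  cases h with
  | deliverClient q' c' m' alive next =>
    unfold Config.clientReceive at hm
    left
    split_ifs at hm <;> exact hm
  | invoke T' =>
    simp only [Config.setPhase, Config.send] at hm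
    split_ifs at hm with hc
    · obtain rfl : c = L.owner T' := by simpa using hc
      rcases List.mem_append.mp hm with hm | hm
      · exact .inl hm
      · refine .inr (.inl ⟨T', ?_, rfl, ?_⟩)
        · cases b <;> simp [toServers] at hm; exact hm
        · simp [Config.setPhase, Config.send]
    · exact .inl hm
  | confirm T' ts v alive phase acks choice =>
    simp only [Config.setPhase, Config.send] at hm
    split_ifs at hm with hc
    · obtain rfl : c = L.owner T' := by simpa using hc
      rcases List.mem_append.mp hm with hm | hm
      · exact .inl hm
      · cases b with
        | client => simp [toServers] at hm
        | server q =>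
          obtain rfl : m = .confirm T' (v + 1) := by simpa [toServers] using hm
          refine .inr (.inr ⟨T', v, ts, rfl, rfl, ⟨q, rfl⟩, phase, ?_, acks, choice, ?_⟩)
          · simp [Config.setPhase, Config.send, Call.Chosen]
          · simp [Config.setPhase, Config.send, toServers]
    · exact .inl hm
  | byzantine s' b' m' faulty able => exact .inl (by simpa using hm)
  | deliverServer | timeout | learnCommit | learnCancel | applyCommit | applyCancel =>
    exact .inl (by simpa [Config.serverStep, Config.send, Config.consume] using hm)
  | _ => exact .inl hm

theorem Step.respond_eq {T : Tx} {r : Option R} (h : Step L byz C (some (.res T r)) C') :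
    ∃ code x, r = answer code x ∧ ∃ A : Finset (Server f), f + 1 ≤ A.card ∧
      ∀ q ∈ A, (q, Msg.resolveAck T code x) ∈ (C.call T).received := by
  cases h with
  | respond _ code x A alive phase enough same => exact ⟨code, x, rfl, A, enough, same⟩

/-! ### What a step of a correct server can change or send. -/

theorem Effect.clock_le (h : Effect L C C' s st out) : (C.server s).clock ≤ st.clock := by
  cases h with
  | message a m next consumed =>
    cases a <;> cases m <;>
      simp [onMessage, onPropose, onProposed, onConfirm_fields, onStartResolution_fields]
  | _ => exact le_rfl

/-- A correct server only relays `Confirm`, and the handler raises the clock in the same step in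
which it relays. -/
theorem Effect.confirm_mem (h : Effect L C C' s st out) {d : Node Client f} {T : Tx} {t : ℕ}
    (hm : .confirm T t ∈ out d) :
    (∃ a, .confirm T t ∈ C.sent a (.server s)) ∧ t ≤ st.clock := by
  cases h with
  | message a m next consumed =>
    cases a <;> cases m <;> simp [onMessage, onPropose, onProposed, onConfirm_out] at hm
    any_goals
      obtain ⟨-, ⟨rfl, rfl⟩, -⟩ := hm
      exact ⟨⟨_, List.mem_of_getElem? next⟩, by simp [onMessage, onConfirm_fields]⟩
    · cases d <;> simp [toServers, toClient] at hm
    · rename_i q T' t' code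
      rcases onStartResolution_cases (Client := Client) (R := R) (C.server s) q T' t' code with
        ⟨⟨-, h2⟩, -⟩ | ⟨-, -, ⟨t'', h2⟩, -⟩ <;> rw [h2] at hm <;> cases d <;> simp [toServers] at hm
  | timeout => cases d <;> simp [startResolve, toServers] at hm
  | learnCommit | learnCancel => simp at hm
  | applyCommit | applyCancel =>
    cases d <;> simp [toClient] at hm

/-- Both kinds of message come from the one handler, so the acknowledged and the broadcast value
coincide. That a server receives nothing else in this step settles the order within the new piece of
the channel. -/
theorem Effect.propose_of_mem (h : Effect L C C' s st out) {d : Node Client f} {T : Tx} {k : ℕ}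
    (hm : .proposed T k ∈ out d ∨ .proposeAck T k ∈ out d) :
    (∃ c, .propose T ∈ C.sent (.client c) (.server s)) ∧ k = (C.server s).clock ∧
      (∀ q, out (.server q) = [.proposed T k]) := by
  cases h with
  | message a m next consumed =>
    cases a <;> cases m <;> simp [onMessage, onPropose, onProposed, onConfirm_out] at hm
    · rename_i c T'
      have : T = T' ∧ k = (C.server s).clock := by
        cases d <;> simp [toServers, toClient] at hm
        · exact hm.2
        · exact hm
      obtain ⟨rfl, rfl⟩ := this
      exact ⟨⟨c, List.mem_of_getElem? next⟩, rfl, fun q => by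
        simp [onMessage, onPropose, toServers, toClient]⟩
    · rename_i q T' t' code
      rcases onStartResolution_cases (Client := Client) (R := R) (C.server s) q T' t' code with
        ⟨⟨-, h2⟩, -⟩ | ⟨-, -, ⟨t'', h2⟩, -⟩ <;> rw [h2] at hm <;> cases d <;> simp [toServers] at hm
  | timeout => cases d <;> simp [startResolve, toServers] at hm
  | learnCommit | learnCancel => simp at hm
  | applyCommit | applyCancel =>
    cases d <;> simp [toClient] at hm

theorem Effect.proposed_mono (h : Effect L C C' s st out) (q : Server f) :
    (C.server s).proposed q ⊆ st.proposed q := by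
  cases h with
  | message a m next consumed =>
    cases a <;> cases m <;>
      simp [onMessage, onPropose, onProposed, onConfirm_fields, onStartResolution_fields]
    all_goals
      rw [Function.update_apply]
      split_ifs with hq
      · subst hq; exact Set.subset_insert _ _
      · exact subset_rfl
  | _ => exact subset_rfl

theorem Effect.proposed_mem (h : Effect L C C' s st out) {q : Server f} {T : Tx} {k : ℕ}
    (hm : (T, k) ∈ st.proposed q) :
    (T, k) ∈ (C.server s).proposed q ∨ (∃ c, .propose T ∈ C.sent (.client c) (.server s)) ∨
      ∃ a, .proposed T k ∈ C.sent a (.server s) := by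
  cases h with
  | message a m next consumed =>
    cases a <;> cases m <;>
      simp [onMessage, onPropose, onProposed, onConfirm_fields, onStartResolution_fields] at hm
    all_goals try exact .inl hm
    all_goals
      rw [Function.update_apply] at hm
      split_ifs at hm with hq
      · subst hq
        rcases hm with hm | hm
        · obtain ⟨rfl, rfl⟩ := Prod.mk.inj hm
          have := List.mem_of_getElem? next
          first | exact .inr (.inl ⟨_, this⟩) | exact .inr (.inr ⟨_, this⟩)
        · exact .inl hm
      · exact .inl hm
  | _ => exact .inl hm

theorem Effect.confirmed_mem (h : Effect L C C' s st out) {T : Tx} {t : ℕ}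
    (hm : T ∈ st.confirmed t) :
    T ∈ (C.server s).confirmed t ∨ ∃ a, .confirm T t ∈ C.sent a (.server s) := by
  cases h with
  | message a m next consumed =>
    cases a <;> cases m <;>
      simp [onMessage, onPropose, onProposed, onConfirm_fields, onStartResolution_fields] at hm
    all_goals try exact .inl hm
    all_goals
      rw [Function.update_apply] at hm
      split_ifs at hm with hq
      · subst hq
        rcases hm with rfl | hm
        · exact .inr ⟨_, List.mem_of_getElem? next⟩
        · exact .inl hm
      · exact .inl hm
  | _ => exact .inl hm

theorem Effect.pending_cases (h : Effect L C C' s st out) (t : ℕ) :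
    st.pending t = (C.server s).pending t ∨
      (C.server s).pending t = ∅ ∧
      ∃ T a, .confirm T t ∈ C.sent a (.server s) ∧ (st.confirmWitness T).card = quorum f ∧
        st.pending t = {T' | ∃ q ∈ st.confirmWitness T, ∃ k ≤ t, (T', k) ∈ st.proposed q} := by
  cases h with
  | message a m next consumed =>
    have key : ∀ T t', m = .confirm T t' → _ := fun T t' _ =>
      onConfirm_pending (R := R) (C.server s) a T t' t
    cases a <;> cases m <;>
      simp [onMessage, onPropose, onProposed, onStartResolution_fields]
    all_goals
      rename_i T t'
      rcases key T t' rfl with h1 | ⟨rfl, h0, h2, h3⟩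
      · exact .inl h1
      · exact .inr ⟨h0, _, ⟨_, List.mem_of_getElem? next⟩, h2, h3⟩
  | _ => exact .inl rfl

/-- A new witness is recorded with the channel position of its message, since the FIFO argument
compares positions. -/
theorem Effect.confirmWitness_mem (h : Effect L C C' s st out) {T : Tx} {q : Server f}
    (hm : q ∈ st.confirmWitness T) :
    q ∈ (C.server s).confirmWitness T ∨ ∃ t,
      (C.sent (.server q) (.server s))[C.rcvd (.server q) (.server s)]? = some (.confirm T t) ∧
      C'.rcvd (.server q) (.server s) = C.rcvd (.server q) (.server s) + 1 := by
  cases h with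
  | message a m next consumed =>
    cases a <;> cases m <;>
      simp [onMessage, onPropose, onProposed, onStartResolution_fields] at hm
    all_goals try exact .inl hm
    all_goals
      rcases onConfirm_confirmWitness _ _ _ _ _ _ hm with hm | ⟨ha, rfl⟩
      · exact .inl hm
      · cases ha
        try exact .inr ⟨_, next, consumed⟩
  | _ => exact .inl hm

theorem Effect.cancelWitness_mem (h : Effect L C C' s st out) {T : Tx} {q : Server f}
    (hm : q ∈ st.cancelWitness T) :
    q ∈ (C.server s).cancelWitness T ∨
      ∃ t, .startResolution T t .cancel ∈ C.sent (.server q) (.server s) := by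
  cases h with
  | message a m next consumed =>
    cases a <;> cases m <;>
      simp [onMessage, onPropose, onProposed, onConfirm_fields] at hm
    all_goals try exact .inl hm
    rcases onStartResolution_cancelWitness _ _ _ _ _ _ _ hm with hm | ⟨rfl, rfl, rfl⟩
    · exact .inl hm
    · exact .inr ⟨_, List.mem_of_getElem? next⟩
  | _ => exact .inl hm

/-- Initial values and announcements change together. The last clause gives the only two causes of a
cancellation: a timer on a pending transaction, or `f + 1` announcements. -/
theorem Effect.resolving_cases (h : Effect L C C' s st out) :
    (st.resolving = (C.server s).resolving ∧
        ∀ T t code d, .startResolution T t code ∉ out d) ∨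
      ∃ T code, (C.server s).resolving T = none ∧
        st.resolving = Function.update (C.server s).resolving T (some code) ∧
        (∃ t, ∀ q, .startResolution T t code ∈ out (.server q)) ∧
        (∀ T' t code' d, .startResolution T' t code' ∈ out d → T' = T ∧ code' = code) ∧
        (code = .cancel → (∃ t, T ∈ (C.server s).pending t) ∨
          f + 1 ≤ (st.cancelWitness T).card) := by
  have hc : ∀ (a : Node Client f) T t, let r := onConfirm (R := R) (C.server s) a T t
      (r.1.resolving = (C.server s).resolving ∧
          ∀ T t code d, .startResolution T t code ∉ r.2 d) ∨
        ∃ T code, (C.server s).resolving T = none ∧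
          r.1.resolving = Function.update (C.server s).resolving T (some code) ∧
          (∃ t, ∀ q, .startResolution T t code ∈ r.2 (.server q)) ∧
          (∀ T' t code' d, .startResolution T' t code' ∈ r.2 d → T' = T ∧ code' = code) ∧
          (code = .cancel → (∃ t, T ∈ (C.server s).pending t) ∨
            f + 1 ≤ (r.1.cancelWitness T).card) := by
    intro a T t
    by_cases hT : (C.server s).resolving T = none
    · refine .inr ⟨T, .commit, hT, ?_, ⟨some t, ?_⟩, ?_, by simp⟩
      · funext T'
        simp [onConfirm_resolving, hT, Function.update_apply]
      · simp [onConfirm_out, hT]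
      · simp [onConfirm_out]
        tauto
    · refine .inl ⟨?_, ?_⟩
      · funext T'
        simp [onConfirm_resolving, hT]
      · simp [onConfirm_out]
        grind
  have hsr : ∀ (q : Server f) T t code,
      let r := onStartResolution (Client := Client) (R := R) (C.server s) q T t code
      (r.1.resolving = (C.server s).resolving ∧
          ∀ T t code d, .startResolution T t code ∉ r.2 d) ∨
        ∃ T code, (C.server s).resolving T = none ∧
          r.1.resolving = Function.update (C.server s).resolving T (some code) ∧
          (∃ t, ∀ q, .startResolution T t code ∈ r.2 (.server q)) ∧
          (∀ T' t code' d, .startResolution T' t code' ∈ r.2 d → T' = T ∧ code' = code) ∧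
          (code = .cancel → (∃ t, T ∈ (C.server s).pending t) ∨
            f + 1 ≤ (r.1.cancelWitness T).card) := by
    intro q T t code
    rcases onStartResolution_cases (Client := Client) (R := R) (C.server s) q T t code with
      ⟨⟨h1, h2⟩, -⟩ | ⟨h0, h1, ⟨t'', h2⟩, h3⟩
    · exact .inl ⟨h1, by simp [h2]⟩
    · refine .inr ⟨T, code, h0, h1, ⟨t'', by simp [h2, toServers]⟩, ?_, fun h => .inr (h3 h)⟩
      intro T' t' code' d hm
      rw [h2] at hm
      cases d <;> simp [toServers] at hm
      exact ⟨hm.1, hm.2.2⟩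
  cases h with
  | message a m next consumed =>
    cases m with
    | confirm T t => cases a <;> exact hc _ T t
    | startResolution T t code =>
      cases a with
      | client => exact .inl (by simp [onMessage])
      | server q => exact hsr q T t code
    | propose T =>
      cases a with
      | client c =>
        refine .inl ⟨rfl, fun T' t code d hm => ?_⟩
        cases d <;> simp [onMessage, onPropose, toServers, toClient] at hm
      | server q => exact .inl (by simp [onMessage])
    | _ => cases a <;> exact .inl (by simp [onMessage, onProposed])
  | timeout t T mem fresh =>
    refine .inr ⟨T, .cancel, fresh, rfl, ⟨none, by simp [startResolve, toServers]⟩, ?_,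
      fun _ => .inl ⟨t, mem⟩⟩
    intro T' t' code' d hm
    cases d <;> simp [startResolve, toServers] at hm
    exact ⟨hm.1, hm.2.2⟩
  | learnCommit | learnCancel => exact .inl (by simp)
  | applyCommit | applyCancel =>
    refine .inl ⟨rfl, fun T' t code d hm => ?_⟩
    cases d <;> simp [toClient] at hm

theorem Effect.outcome_cases (h : Effect L C C' s st out) :
    (st.committed = (C.server s).committed ∨ ∃ T, C.decision T = some .commit ∧
      (C.server s).resolving T ≠ none ∧ st.committed = insert T (C.server s).committed) ∧
    (st.cancelled = (C.server s).cancelled ∨ ∃ T, C.decision T = some .cancel ∧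
      (C.server s).resolving T ≠ none ∧ st.cancelled = insert T (C.server s).cancelled) := by
  cases h with
  | message a m next consumed =>
    cases a <;> cases m <;>
      simp [onMessage, onPropose, onProposed, onConfirm_fields, onStartResolution_fields]
  | learnCommit T decided joined => exact ⟨.inr ⟨T, decided, joined, rfl⟩, .inl rfl⟩
  | learnCancel T decided joined => exact ⟨.inl rfl, .inr ⟨T, decided, joined, rfl⟩⟩
  | _ => exact ⟨.inl rfl, .inl rfl⟩

theorem Effect.log_cases (h : Effect L C C' s st out) :
    (st.log = (C.server s).log ∧ st.store = (C.server s).store ∧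
        ∀ T code r d, .resolveAck T code r ∉ out d) ∨
      (∃ T, Applicable L (C.server s) T ∧ st.log = (C.server s).log ++ [T] ∧
        st.store = ((L.txn T).apply (C.server s).store).1 ∧
        ∀ T' code r d, .resolveAck T' code r ∈ out d →
          T' = T ∧ code = .commit ∧ r = some ((L.txn T).apply (C.server s).store).2) ∨
      ∃ T, T ∈ (C.server s).cancelled ∧ T ∉ (C.server s).log ∧
        st.log = (C.server s).log ++ [T] ∧ st.store = (C.server s).store ∧
        ∀ T' code r d, .resolveAck T' code r ∈ out d → T' = T ∧ code = .cancel ∧ r = none := by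
  cases h with
  | message a m next consumed =>
    left
    cases a <;> cases m <;>
      simp [onMessage, onPropose, onProposed, onConfirm_fields, onStartResolution_fields,
        onConfirm_out]
    · intro T code r d
      cases d <;> simp [toServers, toClient]
    · rename_i q T' t' code
      intro T c r d
      rcases onStartResolution_cases (Client := Client) (R := R) (C.server s) q T' t' code with
        ⟨⟨-, h2⟩, -⟩ | ⟨-, -, ⟨t'', h2⟩, -⟩ <;> rw [h2] <;> cases d <;> simp [toServers]
  | timeout =>
    refine .inl ⟨rfl, rfl, fun T code r d => ?_⟩
    cases d <;> simp [startResolve, toServers]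
  | learnCommit | learnCancel => exact .inl ⟨rfl, rfl, by simp⟩
  | applyCommit T ready =>
    refine .inr (.inl ⟨T, ready, rfl, rfl, fun T' code r d hm => ?_⟩)
    cases d <;> simp [toClient] at hm
    exact hm.2
  | applyCancel T mem fresh =>
    refine .inr (.inr ⟨T, mem, fresh, rfl, rfl, fun T' code r d hm => ?_⟩)
    cases d <;> simp [toClient] at hm
    exact hm.2

end Local

/-! ### Persistence of channels, decisions and announcements. -/

section Invariants

variable {Client Tx K V R : Type*} [LinearOrder Tx] {f : ℕ}
  {L : Ledger Client Tx K V R} {byz : Finset (Server f)} (ρ : Execution L byz)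
  {i j : ℕ} {s q : Server f} {a b : Node Client f} {T T' : Tx}

theorem Execution.sent_prefix (hij : i ≤ j) (a b : Node Client f) :
    (ρ.C i).sent a b <+: (ρ.C j).sent a b := by
  induction j, hij using Nat.le_induction with
  | base => exact List.prefix_rfl
  | succ j _ ih => exact ih.trans ((ρ.step j).sent_prefix a b)

theorem Execution.sent_mono (hij : i ≤ j) {m : Msg Tx R} (hm : m ∈ (ρ.C i).sent a b) :
    m ∈ (ρ.C j).sent a b :=
  (ρ.sent_prefix hij a b).subset hm

theorem Execution.rcvd_le (i : ℕ) (a b : Node Client f) :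
    (ρ.C i).rcvd a b ≤ ((ρ.C i).sent a b).length := by
  induction i with
  | zero => simp [ρ.start, Config.start]
  | succ i ih => exact (ρ.step i).rcvd_le ih

theorem Execution.rcvd_mono (hij : i ≤ j) (a b : Node Client f) :
    (ρ.C i).rcvd a b ≤ (ρ.C j).rcvd a b := by
  induction j, hij using Nat.le_induction with
  | base => exact le_rfl
  | succ j _ ih => exact ih.trans ((ρ.step j).rcvd_mono a b)

theorem Step.delivered_mono {C C' : Config Client Tx K V R f} {e : Option (Event Tx R)}
    (h : Step L byz C e C') {p : ℕ} {m : Msg Tx R} (hd : Delivered C a s p m) :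
    Delivered C' a s p m := by
  obtain ⟨hp, hm⟩ := hd
  refine ⟨hp.trans_le (h.rcvd_mono _ _), ?_⟩
  obtain ⟨l, hl⟩ := h.sent_prefix a (.server s)
  rwa [← hl, List.getElem?_append_left (List.getElem?_eq_some_iff.mp hm).1]

theorem Execution.decision_mono (hij : i ≤ j) {v : Code} (h : (ρ.C i).decision T = some v) :
    (ρ.C j).decision T = some v := by
  induction j, hij using Nat.le_induction with
  | base => exact h
  | succ j _ ih => exact (ρ.step j).decision_mono ih

theorem Execution.resolving_mono (hs : s ∉ byz) (hij : i ≤ j) {v : Code}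
    (h : ((ρ.C i).server s).resolving T = some v) :
    ((ρ.C j).server s).resolving T = some v := by
  induction j, hij using Nat.le_induction with
  | base => exact h
  | succ j _ ih =>
    rcases (ρ.step j).correct hs with ⟨h1, -⟩ | ⟨out, h1, -⟩
    · rwa [h1]
    · rcases h1.resolving_cases with ⟨h2, -⟩ | ⟨T', code, h0, h2, -⟩
      · rwa [h2]
      · have : T ≠ T' := by rintro rfl; simp [ih] at h0
        simpa [h2, this] using ih

theorem Execution.committed_decision (hs : s ∉ byz) (h : T ∈ ((ρ.C i).server s).committed) :
    (ρ.C i).decision T = some .commit := by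
  induction i with
  | zero => simp [ρ.start, Config.start, ServerState.start] at h
  | succ i ih =>
    rcases (ρ.step i).correct hs with ⟨h1, -⟩ | ⟨out, h1, -⟩
    · exact (ρ.step i).decision_mono (ih (h1 ▸ h))
    · rcases h1.outcome_cases.1 with h2 | ⟨T', h2, -, h3⟩
      · exact (ρ.step i).decision_mono (ih (h2 ▸ h))
      · rw [h3] at h
        rcases h with rfl | h
        · exact (ρ.step i).decision_mono h2
        · exact (ρ.step i).decision_mono (ih h)

theorem Execution.cancelled_decision (hs : s ∉ byz) (h : T ∈ ((ρ.C i).server s).cancelled) :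
    (ρ.C i).decision T = some .cancel := by
  induction i with
  | zero => simp [ρ.start, Config.start, ServerState.start] at h
  | succ i ih =>
    rcases (ρ.step i).correct hs with ⟨h1, -⟩ | ⟨out, h1, -⟩
    · exact (ρ.step i).decision_mono (ih (h1 ▸ h))
    · rcases h1.outcome_cases.2 with h2 | ⟨T', h2, -, h3⟩
      · exact (ρ.step i).decision_mono (ih (h2 ▸ h))
      · rw [h3] at h
        rcases h with rfl | h
        · exact (ρ.step i).decision_mono h2
        · exact (ρ.step i).decision_mono (ih h)

theorem Execution.decision_unique {v v' : Code} (h : (ρ.C i).decision T = some v)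
    (h' : (ρ.C j).decision T = some v') : v = v' := by
  have h1 := ρ.decision_mono (le_max_left i j) h
  have h2 := ρ.decision_mono (le_max_right i j) h'
  exact Option.some_injective _ (h1.symm.trans h2)

theorem Execution.decision_resolving {v : Code} (h : (ρ.C i).decision T = some v) :
    ∃ s ∉ byz, ((ρ.C i).server s).resolving T = some v := by
  induction i with
  | zero => simp [ρ.start, Config.start] at h
  | succ i ih =>
    have : ∃ s ∉ byz, ((ρ.C i).server s).resolving T = some v :=
      ((ρ.step i).decision_valid h).elim ih id
    obtain ⟨s, hs, h⟩ := this
    exact ⟨s, hs, ρ.resolving_mono hs (Nat.le_succ i) h⟩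

theorem Execution.resolving_sent (hs : s ∉ byz) {v : Code}
    (h : ((ρ.C i).server s).resolving T = some v) :
    ∃ t, ∀ q, .startResolution T t v ∈ (ρ.C i).sent (.server s) (.server q) := by
  induction i with
  | zero => simp [ρ.start, Config.start, ServerState.start] at h
  | succ i ih =>
    rcases (ρ.step i).correct hs with ⟨h1, h2⟩ | ⟨out, h1, h2⟩
    · simpa [h2] using ih (h1 ▸ h)
    · rcases h1.resolving_cases with ⟨h3, -⟩ | ⟨T', code, -, h3, ⟨t, h4⟩, -⟩
      · obtain ⟨t, ht⟩ := ih (h3 ▸ h)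
        exact ⟨t, fun q => by simp [h2, ht]⟩
      · by_cases hT : T = T'
        · subst hT
          obtain rfl : code = v := by simpa [h3] using h
          exact ⟨t, fun q => by simp [h2, h4]⟩
        · obtain ⟨t, ht⟩ := ih (by simpa [h3, hT] using h)
          exact ⟨t, fun q => by simp [h2, ht]⟩

theorem Execution.resolving_of_sent (hs : s ∉ byz) {t : Option ℕ} {v : Code}
    (h : .startResolution T t v ∈ (ρ.C i).sent (.server s) b) :
    ((ρ.C i).server s).resolving T = some v := by
  induction i with
  | zero => simp [ρ.start, Config.start] at h
  | succ i ih =>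
    rcases (ρ.step i).correct hs with ⟨h1, h2⟩ | ⟨out, h1, h2⟩
    · rw [h1]; exact ih (h2 b ▸ h)
    · rw [h2] at h
      rcases List.mem_append.mp h with h | h
      · exact ρ.resolving_mono hs (Nat.le_succ i) (ih h)
      · rcases h1.resolving_cases with ⟨-, h3⟩ | ⟨T', code, -, h3, -, h4, -⟩
        · exact absurd h (h3 _ _ _ _)
        · obtain ⟨rfl, rfl⟩ := h4 _ _ _ _ h
          simp [h3]

/-- A single COMMIT announcement, from any server, forces participation. For CANCEL this fails,
since `f + 1` witnesses are required. -/
theorem Execution.resolving_of_delivered (hs : s ∉ byz) {p : ℕ} {t : Option ℕ}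
    (h : Delivered (ρ.C i) (.server q) s p (.startResolution T t .commit)) :
    ((ρ.C i).server s).resolving T ≠ none := by
  induction i with
  | zero => simp [Delivered, ρ.start, Config.start] at h
  | succ i ih =>
    rcases (ρ.step i).delivered (ρ.rcvd_le _ _ _) h with h | h
    · obtain ⟨v, hv⟩ := Option.ne_none_iff_exists'.mp (ih h)
      simp [ρ.resolving_mono hs (Nat.le_succ i) hv]
    · rw [h]
      simp only [onMessage, onStartResolution, startResolve]
      split_ifs with h0
      · simp
      · exact h0

/-! ### Every trace of a transaction comes after its invocation. -/

theorem Execution.invoked (h : ((ρ.C i).call T).phase ≠ .idle) :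
    ∃ j < i, ρ.ev j = some (.inv T) := by
  induction i with
  | zero => simp [ρ.start, Config.start] at h
  | succ i ih =>
    rcases (ρ.step i).started h with h | h
    · obtain ⟨j, hj, h⟩ := ih h
      exact ⟨j, by omega, h⟩
    · exact ⟨i, by omega, h⟩

theorem Execution.started_of_propose {c : Client}
    (h : .propose T ∈ (ρ.C i).sent (.client c) b) : ((ρ.C i).call T).phase ≠ .idle := by
  induction i with
  | zero => simp [ρ.start, Config.start] at h
  | succ i ih =>
    rcases (ρ.step i).client_sent h with h | ⟨T', h, -, h'⟩ | ⟨T', v, ts, h, -⟩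
    · exact (ρ.step i).phase_mono (ih h)
    · cases h; exact h'
    · cases h

theorem Execution.chosen_of_confirm {c : Client} {t : ℕ}
    (h : .confirm T t ∈ (ρ.C i).sent (.client c) b) :
    c = L.owner T ∧ (∃ q, b = .server q) ∧ ((ρ.C i).call T).Chosen := by
  induction i with
  | zero => simp [ρ.start, Config.start] at h
  | succ i ih =>
    rcases (ρ.step i).client_sent h with h | ⟨T', h, -, h'⟩ | ⟨T', v, ts, h, h1, h2, -, h3, -⟩
    · obtain ⟨h1, h2, h3⟩ := ih h
      exact ⟨h1, h2, (ρ.step i).chosen_mono h3⟩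
    · cases h
    · cases h; exact ⟨h1, h2, h3⟩

theorem Execution.started_of_proposed {k : ℕ} (h : .proposed T k ∈ (ρ.C i).sent a b) :
    ((ρ.C i).call T).phase ≠ .idle := by
  induction i with
  | zero => simp [ρ.start, Config.start] at h
  | succ i ih =>
    suffices .proposed T k ∈ (ρ.C i).sent a b ∨
        ∃ c s, .propose T ∈ (ρ.C i).sent (.client c) (.server s) by
      rcases this with h | ⟨c, s, h⟩
      · exact (ρ.step i).phase_mono (ih h)
      · exact (ρ.step i).phase_mono (ρ.started_of_propose h)
    cases a with
    | client c =>
      rcases (ρ.step i).client_sent h with h | ⟨T', h, -⟩ | ⟨T', v, ts, h, -⟩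
      · exact .inl h
      · cases h
      · cases h
    | server s =>
      by_cases hs : s ∈ byz
      · rcases (ρ.step i).byzantine_sent hs h with h | ⟨q, h⟩
        · exact .inl h
        · exact .inr ⟨_, q, h⟩
      · rcases (ρ.step i).correct hs with ⟨-, h2⟩ | ⟨out, h1, h2⟩
        · exact .inl (h2 b ▸ h)
        · rw [h2] at h
          rcases List.mem_append.mp h with h | h
          · exact .inl h
          · obtain ⟨⟨c, h⟩, -⟩ := h1.propose_of_mem (.inl h)
            exact .inr ⟨c, s, h⟩

theorem Execution.started_of_mem_proposed (hs : s ∉ byz) {k : ℕ}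
    (h : (T, k) ∈ ((ρ.C i).server s).proposed q) : ((ρ.C i).call T).phase ≠ .idle := by
  induction i with
  | zero => simp [ρ.start, Config.start, ServerState.start] at h
  | succ i ih =>
    apply (ρ.step i).phase_mono
    rcases (ρ.step i).correct hs with ⟨h1, -⟩ | ⟨out, h1, -⟩
    · exact ih (h1 ▸ h)
    · rcases h1.proposed_mem h with h | ⟨c, h⟩ | ⟨a, h⟩
      · exact ih h
      · exact ρ.started_of_propose h
      · exact ρ.started_of_proposed h

theorem Execution.started_of_mem_pending (hs : s ∉ byz) {t : ℕ}
    (h : T ∈ ((ρ.C i).server s).pending t) : ((ρ.C i).call T).phase ≠ .idle := by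
  induction i with
  | zero => simp [ρ.start, Config.start, ServerState.start] at h
  | succ i ih =>
    rcases (ρ.step i).correct hs with ⟨h1, -⟩ | ⟨out, h1, -⟩
    · exact (ρ.step i).phase_mono (ih (h1 ▸ h))
    · rcases h1.pending_cases t with h2 | ⟨-, T', a, -, -, h2⟩
      · exact (ρ.step i).phase_mono (ih (h2 ▸ h))
      · rw [h2] at h
        obtain ⟨q, -, k, -, h⟩ := h
        exact ρ.started_of_mem_proposed hs h

/-- A cancellation starts from a pending transaction, which was proposed, or from `f + 1`
announcements. One of these is from a correct server that was already cancelling. -/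
theorem Execution.started_of_resolving (hbyz : byz.card ≤ f) (hs : s ∉ byz)
    (h : ((ρ.C i).server s).resolving T = some .cancel) : ((ρ.C i).call T).phase ≠ .idle := by
  -- The two claims feed each other: a correct cancel witness comes from an earlier cancellation,
  -- and a cancellation may come from a correct witness.
  suffices H : (∀ s ∉ byz, ((ρ.C i).server s).resolving T = some .cancel →
      ((ρ.C i).call T).phase ≠ .idle) ∧ ∀ s ∉ byz, ∀ q ∉ byz,
      q ∈ ((ρ.C i).server s).cancelWitness T → ((ρ.C i).call T).phase ≠ .idle from H.1 s hs h
  clear h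
  induction i with
  | zero => simp [ρ.start, Config.start, ServerState.start]
  | succ i ih =>
    have hw : ∀ s ∉ byz, ∀ q ∉ byz, q ∈ ((ρ.C (i + 1)).server s).cancelWitness T →
        ((ρ.C (i + 1)).call T).phase ≠ .idle := by
      intro s hs q hq h
      apply (ρ.step i).phase_mono
      rcases (ρ.step i).correct hs with ⟨h1, -⟩ | ⟨out, h1, -⟩
      · exact ih.2 s hs q hq (h1 ▸ h)
      · rcases h1.cancelWitness_mem h with h | ⟨t, h⟩
        · exact ih.2 s hs q hq h
        · exact ih.1 q hq (ρ.resolving_of_sent hq h)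
    refine ⟨fun s hs h => ?_, hw⟩
    rcases (ρ.step i).correct hs with ⟨h1, -⟩ | ⟨out, h1, -⟩
    · exact (ρ.step i).phase_mono (ih.1 s hs (h1 ▸ h))
    · rcases h1.resolving_cases with ⟨h2, -⟩ | ⟨T', code, -, h2, -, -, h3⟩
      · exact (ρ.step i).phase_mono (ih.1 s hs (h2 ▸ h))
      · by_cases hT : T = T'
        · subst hT
          obtain rfl : code = .cancel := by simpa [h2] using h
          rcases h3 rfl with ⟨t, h⟩ | h
          · exact (ρ.step i).phase_mono (ρ.started_of_mem_pending hs h)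
          · obtain ⟨q, hq, hqb⟩ := Finset.exists_mem_notMem_of_card_lt_card
              (hbyz.trans_lt (Nat.lt_of_succ_le h))
            exact hw s hs q hqb hq
        · exact (ρ.step i).phase_mono (ih.1 s hs (by simpa [h2, hT] using h))

/-! ### Timestamps and the acknowledgements behind them. -/

theorem Execution.signed_mono (hij : i ≤ j) {m : Msg Tx R} (h : Signed L (ρ.C i) T m) :
    Signed L (ρ.C j) T m :=
  h.imp fun _ hq => ρ.sent_mono hij hq

/-- Following relays backwards ends at the client: clients confirm only their own transactions, and
a Byzantine sender must already hold a signed message. -/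
theorem Execution.signed_of_confirm {t : ℕ} (h : .confirm T t ∈ (ρ.C i).sent a b) :
    Signed L (ρ.C i) T (.confirm T t) := by
  induction i generalizing a b with
  | zero => simp [ρ.start, Config.start] at h
  | succ i ih =>
    cases a with
    | client c =>
      obtain ⟨rfl, ⟨q, rfl⟩, -⟩ := ρ.chosen_of_confirm h
      exact ⟨q, h⟩
    | server s =>
      apply ρ.signed_mono (Nat.le_succ i)
      by_cases hs : s ∈ byz
      · rcases (ρ.step i).byzantine_sent hs h with h | h
        · exact ih h
        · exact h
      · rcases (ρ.step i).correct hs with ⟨-, h2⟩ | ⟨out, h1, h2⟩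
        · exact ih (h2 b ▸ h)
        · rw [h2] at h
          rcases List.mem_append.mp h with h | h
          · exact ih h
          · obtain ⟨⟨a, h⟩, -⟩ := h1.confirm_mem h
            exact ih h

theorem Execution.signed_of_confirmed (hs : s ∉ byz) {t : ℕ}
    (h : T ∈ ((ρ.C i).server s).confirmed t) : Signed L (ρ.C i) T (.confirm T t) := by
  induction i with
  | zero => simp [ρ.start, Config.start, ServerState.start] at h
  | succ i ih =>
    apply ρ.signed_mono (Nat.le_succ i)
    rcases (ρ.step i).correct hs with ⟨h1, -⟩ | ⟨out, h1, -⟩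
    · exact ih (h1 ▸ h)
    · rcases h1.confirmed_mem h with h | ⟨a, h⟩
      · exact ih h
      · exact ρ.signed_of_confirm h

/-- The client of `T` sends `Confirm(T, t)` in the execution. -/
def Execution.Stamp (T : Tx) (t : ℕ) : Prop := ∃ i, Signed L (ρ.C i) T (.confirm T t)

/-- Sending `Confirm` requires the phase `proposing`, and the call leaves this phase for good in
doing so. -/
theorem Execution.stamp_unique {t t' : ℕ} (h : ρ.Stamp T t) (h' : ρ.Stamp T t') : t = t' := by
  obtain ⟨i, h⟩ := h
  obtain ⟨j, h'⟩ := h'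
  replace h := ρ.signed_mono (le_max_left i j) h
  replace h' := ρ.signed_mono (le_max_right i j) h'
  generalize max i j = l at h h'
  obtain ⟨q, h⟩ := h
  obtain ⟨q', h'⟩ := h'
  induction l with
  | zero => simp [ρ.start, Config.start] at h
  | succ l ih =>
    rcases (ρ.step l).client_sent h with h1 | ⟨_, h1, -⟩ | ⟨T₁, v, ts, h1, -, -, hp, -, -, -, hs⟩
    · rcases (ρ.step l).client_sent h' with h2 | ⟨_, h2, -⟩ | ⟨T₂, v, ts, h2, -, -, hp, -⟩
      · exact ih h1 h2
      · cases h2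
      · cases h2
        exact absurd hp (ρ.chosen_of_confirm h1).2.2.2
    · cases h1
    · cases h1
      -- The first message is new. The second is either older, against the phase, or part of the
      -- same broadcast, hence identical.
      rw [hs] at h'
      rcases List.mem_append.mp h' with h' | h'
      · exact absurd hp (ρ.chosen_of_confirm h').2.2.2
      · simpa [eq_comm] using h'

theorem Execution.received_sent {m : Msg Tx R} (h : (q, m) ∈ ((ρ.C i).call T).received) :
    m ∈ (ρ.C i).sent (.server q) (.client (L.owner T)) := by
  induction i with
  | zero => simp [ρ.start, Config.start] at h
  | succ i ih =>
    exact ρ.sent_mono (Nat.le_succ i) (((ρ.step i).received h).elim ih id)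

theorem Execution.proposed_of_ack (hq : q ∉ byz) {k : ℕ}
    (h : .proposeAck T k ∈ (ρ.C i).sent (.server q) b) (s : Server f) :
    .proposed T k ∈ (ρ.C i).sent (.server q) (.server s) := by
  induction i with
  | zero => simp [ρ.start, Config.start] at h
  | succ i ih =>
    rcases (ρ.step i).correct hq with ⟨-, h2⟩ | ⟨out, h1, h2⟩
    · rw [h2] at h ⊢; exact ih h
    · rw [h2] at h ⊢
      rcases List.mem_append.mp h with h | h
      · exact List.mem_append_left _ (ih h)
      · simp [(h1.propose_of_mem (.inr h)).2.2 s]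

-- For a correct `q` in `A`, the value in the client's table is one that `q` also announced to all
-- servers. This links the choice of the timestamp to what servers may collect in `pending`.
open Classical in
theorem Execution.support {t : ℕ} (h : Signed L (ρ.C i) T (.confirm T t)) :
    ∃ ts v, ∃ A : Finset (Server f), t = v + 1 ∧ IsNthLargest ts f v ∧ quorum f ≤ A.card ∧
      ∀ q ∈ A, q ∉ byz → ∀ s, .proposed T (ts q) ∈ (ρ.C i).sent (.server q) (.server s) := by
  obtain ⟨q, h⟩ := h
  induction i with
  | zero => simp [ρ.start, Config.start] at h
  | succ i ih =>
    rcases (ρ.step i).client_sent h with h | ⟨_, h, -⟩ | ⟨T', v, ts, h, -, -, -, -, hc, hn, -⟩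
    · obtain ⟨ts, v, A, h1, h2, h3, h4⟩ := ih h
      exact ⟨ts, v, A, h1, h2, h3, fun q hq hb s => ρ.sent_mono (Nat.le_succ i) (h4 q hq hb s)⟩
    · cases h
    · cases h
      refine ⟨ts, v, _, rfl, hn, hc.1, fun q hq hb s => ?_⟩
      exact ρ.sent_mono (Nat.le_succ i)
        (ρ.proposed_of_ack hb (ρ.received_sent ((hc.2 q).1 (Finset.mem_filter.mp hq).2)) s)

/-! ### Clocks, FIFO order and completeness of the pending sets. -/

theorem Execution.le_clock (hq : q ∉ byz) {t : ℕ}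
    (h : .confirm T t ∈ (ρ.C i).sent (.server q) b) : t ≤ ((ρ.C i).server q).clock := by
  induction i with
  | zero => simp [ρ.start, Config.start] at h
  | succ i ih =>
    rcases (ρ.step i).correct hq with ⟨h1, h2⟩ | ⟨out, h1, h2⟩
    · rw [h1]; exact ih (h2 b ▸ h)
    · rw [h2] at h
      rcases List.mem_append.mp h with h | h
      · exact (ih h).trans h1.clock_le
      · exact (h1.confirm_mem h).2

/-- After relaying a `Confirm` with timestamp `t`, a correct server has clock at least `t`, and
later proposals carry the current clock. -/
theorem Execution.pairwise_sent (i : ℕ) (hq : q ∉ byz) (s : Server f) :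
    ((ρ.C i).sent (.server q) (.server s)).Pairwise fun m m' =>
      ∀ T t T' k, m = .confirm T t → m' = .proposed T' k → t ≤ k := by
  induction i with
  | zero => simp [ρ.start, Config.start]
  | succ i ih =>
    rcases (ρ.step i).correct hq with ⟨h1, h2⟩ | ⟨out, h1, h2⟩
    · rwa [h2]
    · rw [h2, List.pairwise_append]
      refine ⟨ih, ?_, ?_⟩
      · by_cases h : ∃ T k, .proposed T k ∈ out (.server s)
        · obtain ⟨T, k, h⟩ := h
          rw [(h1.propose_of_mem (.inl h)).2.2 s]
          exact List.pairwise_singleton _ _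
        · refine List.Pairwise.imp_of_mem (R := fun _ _ => True) ?_ (List.pairwise_of_forall
            fun _ _ => trivial)
          rintro m m' - hm' - T t T' k - rfl
          exact absurd ⟨_, _, hm'⟩ h
      · rintro m hm m' hm' T t T' k rfl rfl
        rw [(h1.propose_of_mem (.inl hm')).2.1]
        exact ρ.le_clock hq hm

theorem Execution.proposed_mono (hs : s ∉ byz) (i : ℕ) :
    ((ρ.C i).server s).proposed q ⊆ ((ρ.C (i + 1)).server s).proposed q := by
  rcases (ρ.step i).correct hs with ⟨h1, -⟩ | ⟨out, h1, -⟩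
  · rw [h1]
  · exact h1.proposed_mono q

theorem Execution.proposed_of_delivered (hs : s ∉ byz) {p k : ℕ}
    (h : Delivered (ρ.C i) (.server q) s p (.proposed T k)) :
    (T, k) ∈ ((ρ.C i).server s).proposed q := by
  induction i with
  | zero => simp [Delivered, ρ.start, Config.start] at h
  | succ i ih =>
    rcases (ρ.step i).delivered (ρ.rcvd_le _ _ _) h with h | h
    · exact ρ.proposed_mono hs i (ih h)
    · simp [h, onMessage, onProposed]

theorem Execution.delivered_of_confirmWitness (hs : s ∉ byz)
    (h : q ∈ ((ρ.C i).server s).confirmWitness T) :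
    ∃ t p, Delivered (ρ.C i) (.server q) s p (.confirm T t) := by
  induction i with
  | zero => simp [ρ.start, Config.start, ServerState.start] at h
  | succ i ih =>
    have hold : q ∈ ((ρ.C i).server s).confirmWitness T →
        ∃ t p, Delivered (ρ.C (i + 1)) (.server q) s p (.confirm T t) := fun h => by
      obtain ⟨t, p, h⟩ := ih h
      exact ⟨t, p, (ρ.step i).delivered_mono h⟩
    rcases (ρ.step i).correct hs with ⟨h1, -⟩ | ⟨out, h1, -⟩
    · exact hold (h1 ▸ h)
    · rcases h1.confirmWitness_mem h with h | ⟨t, h2, h3⟩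
      · exact hold h
      · refine ⟨t, _, by rw [h3]; exact Nat.lt_succ_self _, ?_⟩
        obtain ⟨l, hl⟩ := (ρ.step i).sent_prefix (.server q) (.server s)
        rwa [← hl, List.getElem?_append_left (List.getElem?_eq_some_iff.mp h2).1]

theorem Execution.pending_stable (hs : s ∉ byz) {t : ℕ} (hij : i ≤ j)
    (h : ((ρ.C i).server s).pending t ≠ ∅) :
    ((ρ.C j).server s).pending t = ((ρ.C i).server s).pending t := by
  induction j, hij using Nat.le_induction with
  | base => rfl
  | succ j _ ih =>
    rcases (ρ.step j).correct hs with ⟨h1, -⟩ | ⟨out, h1, -⟩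
    · rwa [h1]
    · rcases h1.pending_cases t with h2 | ⟨h0, -⟩
      · rwa [h2]
      · exact absurd (ih ▸ h0) h

/-- Once `pending[t]` is determined at `s`, what is missing from it is proposed by the members of a
quorum with values that are at least `t` only. -/
theorem Execution.pending_complete (hs : s ∉ byz) {t : ℕ}
    (h : ((ρ.C i).server s).pending t ≠ ∅) :
    ∃ W : Finset (Server f), quorum f ≤ W.card ∧ ∀ q ∈ W, q ∉ byz →
      (∃ T, .confirm T t ∈ (ρ.C i).sent (.server q) (.server s)) ∧
      ∀ T k, .proposed T k ∈ (ρ.C i).sent (.server q) (.server s) →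
        T ∈ ((ρ.C i).server s).pending t ∨ t ≤ k := by
  induction i with
  | zero => simp [ρ.start, Config.start, ServerState.start] at h
  | succ i ih =>
    -- If the set is unchanged, only fresh proposals need care. Their sender has already sent a
    -- `Confirm` with timestamp `t`, so its clock is at least `t`.
    by_cases h1 : ((ρ.C (i + 1)).server s).pending t = ((ρ.C i).server s).pending t
    · obtain ⟨W, hW, hq⟩ := ih (h1 ▸ h)
      refine ⟨W, hW, fun q hqW hqb => ?_⟩
      obtain ⟨⟨T, hT⟩, h2⟩ := hq q hqW hqb
      refine ⟨⟨T, ρ.sent_mono (Nat.le_succ i) hT⟩, fun T' k hk => ?_⟩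
      rw [h1]
      rcases (ρ.step i).correct hqb with ⟨-, h3⟩ | ⟨out, h3, h4⟩
      · exact h2 T' k (h3 _ ▸ hk)
      · rw [h4] at hk
        rcases List.mem_append.mp hk with hk | hk
        · exact h2 T' k hk
        · rw [(h3.propose_of_mem (.inl hk)).2.1]
          exact .inr (ρ.le_clock hqb hT)
    rcases (ρ.step i).correct hs with ⟨h', -⟩ | ⟨out, h', -⟩
    · exact absurd (by rw [h']) h1
    · rcases h'.pending_cases t with h2 | ⟨-, T, a, hT, hc, h2⟩
      · exact absurd h2 h1
      · refine ⟨_, hc.ge, fun q hqW hqb => ?_⟩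
        obtain ⟨t', p, hp, hm⟩ := ρ.delivered_of_confirmWitness hs hqW
        -- Witnesses are recorded per transaction and not per timestamp; uniqueness of the timestamp
        -- repairs this.
        have ht : t' = t := ρ.stamp_unique ⟨_, ρ.signed_of_confirm (List.mem_of_getElem? hm)⟩
          ⟨_, ρ.signed_of_confirm hT⟩
        subst ht
        refine ⟨⟨T, List.mem_of_getElem? hm⟩, fun T' k hk => ?_⟩
        by_contra! hlt
        obtain ⟨p', hp', hk⟩ := List.mem_iff_getElem.mp hk
        obtain ⟨hpl, hm⟩ := List.getElem?_eq_some_iff.mp hm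
        -- A proposal with value below `t` must stand before the `Confirm` in the channel, so it was
        -- delivered before the set was computed.
        have hle : p' ≤ p := by
          by_contra! hpp
          exact absurd (List.pairwise_iff_getElem.mp (ρ.pairwise_sent (i + 1) hqb s) p p' hpl hp' hpp
            _ _ _ _ hm hk) (not_le.mpr hlt.2)
        apply hlt.1
        rw [h2]
        exact ⟨q, hqW, k, hlt.2.le, ρ.proposed_of_delivered hs (p := p')
          ⟨hle.trans_lt hp, List.getElem?_eq_some_iff.mpr ⟨hp', hk⟩⟩⟩

open Classical in
/-- A transaction that is missing from `pending[t]` gets a timestamp larger than `t`. -/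
theorem Execution.lt_stamp (hbyz : byz.card ≤ f) (hs : s ∉ byz) {t t' : ℕ}
    (h : ((ρ.C i).server s).pending t ≠ ∅) (hT : T ∉ ((ρ.C i).server s).pending t)
    (ht : ρ.Stamp T t') : t < t' := by
  obtain ⟨j, ht⟩ := ht
  -- A configuration is needed in which the pending set is fixed and the acknowledgements for `T`
  -- have all been sent.
  obtain ⟨l, hil, hjl⟩ : ∃ l, i ≤ l ∧ j ≤ l := ⟨_, le_max_left i j, le_max_right i j⟩
  have hst := ρ.pending_stable hs hil h
  rw [← hst] at h hT
  obtain ⟨ts, v, A, rfl, hv, hA, hA'⟩ := ρ.support (ρ.signed_mono hjl ht)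
  obtain ⟨W, hW, hW'⟩ := ρ.pending_complete hs h
  by_contra! hlt
  -- The values reported by these servers are at least `t`, and `v + 1 ≤ t` is assumed for
  -- contradiction.
  have hsub : (W ∩ A) \ byz ⊆ Finset.univ.filter fun q => v < ts q := by
    intro q hq
    simp only [Finset.mem_sdiff, Finset.mem_inter] at hq
    obtain ⟨⟨hqW, hqA⟩, hqb⟩ := hq
    rcases (hW' q hqW hqb).2 T _ (hA' q hqA hqb s) with h | h
    · exact absurd h hT
    · simp only [Finset.mem_filter, Finset.mem_univ, true_and]
      omega
  -- At least `2(3f + 1) - (4f + 1) - f = f + 1` values would exceed `v`, while the choice of `v`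
  -- allows at most `f`.
  have h1 := (Finset.card_le_card hsub).trans (by convert hv.1)
  have h2 := Finset.le_card_sdiff byz (W ∩ A)
  have h3 := Finset.card_union_add_card_inter W A
  have h4 : (W ∪ A).card ≤ 4 * f + 1 := by simpa using Finset.card_le_univ (W ∪ A)
  unfold quorum at hW hA
  omega

/-- `T` precedes `T'` in the order of timestamps, ties being resolved by the canonical order. -/
def Execution.Before (T T' : Tx) : Prop :=
  ∃ t t', ρ.Stamp T t ∧ ρ.Stamp T' t' ∧ (t < t' ∨ t = t' ∧ T < T')

theorem Execution.Before.asymm {ρ : Execution L byz} (h : ρ.Before T T') : ¬ ρ.Before T' T := by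
  rintro ⟨t₂', t₂, h2', h2, hlt'⟩
  obtain ⟨t₁, t₁', h1, h1', hlt⟩ := h
  obtain rfl := ρ.stamp_unique h1 h2
  obtain rfl := ρ.stamp_unique h1' h2'
  rcases hlt with hlt | ⟨rfl, hlt⟩
  · omega
  · rcases hlt' with hlt' | ⟨-, hlt'⟩
    · omega
    · exact lt_asymm hlt hlt'

/-- What a correct server applies before a conflicting transaction precedes that transaction. -/
theorem Execution.before_of_applicable (hbyz : byz.card ≤ f) (hs : s ∉ byz)
    (h : Applicable L ((ρ.C i).server s) T) (hne : T' ≠ T)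
    (hconf : (L.txn T).Conflict (L.txn T')) (hlog : T' ∉ ((ρ.C i).server s).log)
    (hdec : (ρ.C j).decision T' = some .commit) {t' : ℕ} (ht' : ρ.Stamp T' t') :
    ρ.Before T T' := by
  obtain ⟨-, t, ⟨-, hct⟩, hp, hall⟩ := h
  have ht : ρ.Stamp T t := ⟨i, ρ.signed_of_confirmed hs hct⟩
  by_cases hmem : T' ∈ ((ρ.C i).server s).pending t
  · rcases hall T' hmem hne with h | h | h | ⟨t₁, h1, h⟩
    · exact absurd hconf h
    · have := ρ.decision_unique hdec (ρ.cancelled_decision hs h)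
      cases this
    · exact absurd h hlog
    · have ht1 : ρ.Stamp T t₁ := ⟨i, ρ.signed_of_confirmed hs h1⟩
      rcases h with ⟨t₂, h2, hlt⟩ | ⟨h2, hlt⟩
      · exact ⟨t₁, t₂, ht1, ⟨i, ρ.signed_of_confirmed hs h2⟩, .inl hlt⟩
      · exact ⟨t₁, t₁, ht1, ⟨i, ρ.signed_of_confirmed hs h2⟩, .inr ⟨rfl, hlt⟩⟩
  -- The server may not even know `T'` here; its absence from `pending t` alone forces a larger
  -- timestamp.
  · exact ⟨t, t', ht, ht', .inl (ρ.lt_stamp hbyz hs hp hmem ht')⟩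

end Invariants

/-! ### Replaying lists that agree on conflicting transactions. -/

section Replay

variable {Client Tx K V R : Type*} (L : Ledger Client Tx K V R)

/-- Agreement is required on the write set too: the code may leave a declared key alone, and then
the old value survives. -/
theorem Transaction.apply_congr {T : Transaction K V R} {σ σ' : K → V}
    (h : ∀ k ∈ T.readSet ∪ T.writeSet, σ k = σ' k) :
    (T.apply σ).2 = (T.apply σ').2 ∧ ∀ k ∈ T.writeSet, (T.apply σ).1 k = (T.apply σ').1 k := by
  have hr : (fun k : T.readSet => σ k) = fun k : T.readSet => σ' k :=
    funext fun k => h k (.inl k.2)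
  refine ⟨by simp only [Transaction.apply, hr], fun k hk => ?_⟩
  simp only [Transaction.apply, hr, h k (.inr hk)]

theorem Transaction.apply_of_notMem {T : Transaction K V R} {σ : K → V} {k : K}
    (h : k ∉ T.writeSet) : (T.apply σ).1 k = σ k := by
  simp [Transaction.apply, h]

theorem Transaction.Conflict.symm {T T' : Transaction K V R} (h : T.Conflict T') :
    T'.Conflict T := Or.symm h

/-- The ledger state after the execution of a list of transactions. -/
noncomputable def run (ℓ : List Tx) : K → V :=
  ℓ.foldl (fun σ T => ((L.txn T).apply σ).1) L.init

theorem run_concat (ℓ : List Tx) (T : Tx) :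
    run L (ℓ ++ [T]) = ((L.txn T).apply (run L ℓ)).1 := by
  simp [run]

theorem run_append_of_notMem {k : K} (a b : List Tx) (h : ∀ T ∈ b, k ∉ (L.txn T).writeSet) :
    run L (a ++ b) k = run L a k := by
  induction b using List.reverseRecOn with
  | nil => simp
  | append_singleton b T ih =>
    rw [← List.append_assoc, run_concat, Transaction.apply_of_notMem (h T (by simp))]
    exact ih fun T' hT' => h T' (by simp [hT'])

theorem exists_last_of_mem {α : Type*} {p : α → Prop} (l : List α) (h : ∃ x ∈ l, p x) :
    ∃ a x b, l = a ++ [x] ++ b ∧ p x ∧ ∀ y ∈ b, ¬ p y := by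
  induction l using List.reverseRecOn with
  | nil => simp at h
  | append_singleton l y ih =>
    by_cases hy : p y
    · exact ⟨l, y, [], by simp, hy, by simp⟩
    · obtain ⟨x, hx, hp⟩ := h
      have hxl : x ∈ l := by
        rcases List.mem_append.mp hx with hx | hx
        · exact hx
        · obtain rfl := List.mem_singleton.mp hx
          exact absurd hp hy
      obtain ⟨a, x, b, rfl, h1, h2⟩ := ih ⟨x, hxl, hp⟩
      refine ⟨a, x, b ++ [y], by simp, h1, fun z hz => ?_⟩
      rcases List.mem_append.mp hz with hz | hz
      · exact h2 z hz
      · rwa [List.mem_singleton.mp hz]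

/-- A list of transactions in `U` is orderly if it is free of repetitions, sorted by `r` as far as
conflicting transactions are concerned, and contains with a transaction all the conflicting ones in
`U` that precede it. -/
def Orderly (U : Set Tx) (r : Tx → Tx → Prop) (ℓ : List Tx) : Prop :=
  ∀ a T, a ++ [T] <+: ℓ → T ∈ U ∧ T ∉ a ∧
    ∀ T' ∈ U, T' ≠ T → (L.txn T).Conflict (L.txn T') → (T' ∈ a → r T' T) ∧ (T' ∉ a → r T T')

variable {L} {U : Set Tx} {r : Tx → Tx → Prop} {ℓ ℓ' : List Tx} {T T' : Tx}

theorem Orderly.nil : Orderly L U r [] := by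
  intro a T h
  simp at h

theorem exists_prefix_of_mem (h : T ∈ ℓ) : ∃ a, a ++ [T] <+: ℓ := by
  obtain ⟨a, b, rfl⟩ := List.append_of_mem h
  exact ⟨a, b, by simp⟩

theorem Orderly.mem (h : Orderly L U r ℓ) (hT : T ∈ ℓ) : T ∈ U := by
  obtain ⟨a, ha⟩ := exists_prefix_of_mem hT
  exact (h a T ha).1

/-- When `T'` was appended, `T` was still absent. -/
theorem Orderly.before_of_mem (h : Orderly L U r ℓ) (hT' : T' ∈ ℓ) (hT : T ∉ ℓ) (hU : T ∈ U)
    (hc : (L.txn T).Conflict (L.txn T')) : r T' T := by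
  obtain ⟨a, ha⟩ := exists_prefix_of_mem hT'
  refine ((h a T' ha).2.2 T hU ?_ hc.symm).2 fun hm => hT (ha.subset (by simp [hm]))
  rintro rfl
  exact hT hT'

/-- Only transactions still absent need a check; for those present, `before_of_mem` gives the order.
-/
theorem Orderly.concat (h : Orderly L U r ℓ) (hU : T ∈ U) (hT : T ∉ ℓ)
    (hr : ∀ T' ∈ U, T' ≠ T → (L.txn T).Conflict (L.txn T') → T' ∉ ℓ → r T T') :
    Orderly L U r (ℓ ++ [T]) := by
  intro a T₁ ha
  rcases List.prefix_concat_iff.mp ha with ha | ha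
  · obtain ⟨rfl, h1⟩ := List.append_inj' ha rfl
    obtain rfl : T₁ = T := by simpa using h1
    exact ⟨hU, hT, fun T' hU' hne hc => ⟨fun hm => h.before_of_mem hm hT hU hc, hr T' hU' hne hc⟩⟩
  · exact h a T₁ ha

/-- If `T'` came before `T` in one list and not in the other, `r` would hold in both directions. So
the conflicting predecessors of `T` are the same in all orderly lists that contain it. -/
theorem Orderly.mem_of_mem (hr : ∀ T T', r T T' → ¬ r T' T) (h : Orderly L U r ℓ)
    (h' : Orderly L U r ℓ') {a a' : List Tx} (ha : a ++ [T] <+: ℓ) (ha' : a' ++ [T] <+: ℓ')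
    (hc : (L.txn T).Conflict (L.txn T')) (hm : T' ∈ a) : T' ∈ a' := by
  by_contra hn
  obtain ⟨-, h2, h3⟩ := h a T ha
  have hne : T' ≠ T := by rintro rfl; exact h2 hm
  have hU : T' ∈ U := h.mem (ha.subset (by simp [hm]))
  exact hr _ _ ((h3 T' hU hne hc).1 hm) (((h' a' T ha').2.2 T' hU hne hc).2 hn)

/-- The state in which a transaction is executed is the same in all orderly lists, as far as the
keys that the transaction accesses are concerned. -/
theorem Orderly.run_eq (hr : ∀ T T', r T T' → ¬ r T' T) (h : Orderly L U r ℓ)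
    (h' : Orderly L U r ℓ') {a a' : List Tx} (ha : a ++ [T] <+: ℓ) (ha' : a' ++ [T] <+: ℓ') :
    ∀ k ∈ (L.txn T).readSet ∪ (L.txn T).writeSet, run L a k = run L a' k := by
  induction hn : a.length using Nat.strong_induction_on generalizing a a' T with
  | _ n ih =>
  intro k hk
  have hconf : ∀ T', k ∈ (L.txn T').writeSet → (L.txn T).Conflict (L.txn T') :=
    fun T' hw => .inr ⟨k, hw, hk⟩
  -- The value at `k` is determined by the last writer of `k`. All writers of `k` conflict with `T`,
  -- so both prefixes contain the same ones.
  by_cases hex : ∃ T' ∈ a, k ∈ (L.txn T').writeSet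
  · have hex' : ∃ T' ∈ a', k ∈ (L.txn T').writeSet := by
      obtain ⟨T', hm, hw⟩ := hex
      exact ⟨T', h.mem_of_mem hr h' ha ha' (hconf T' hw) hm, hw⟩
    obtain ⟨a₁, T₁, b₁, rfl, hw₁, hb₁⟩ := exists_last_of_mem a hex
    obtain ⟨a₂, T₂, b₂, rfl, hw₂, hb₂⟩ := exists_last_of_mem a' hex'
    have hp₁ : a₁ ++ [T₁] <+: ℓ :=
      ((List.prefix_append _ b₁).trans (List.prefix_append _ [T])).trans ha
    have hp₂ : a₂ ++ [T₂] <+: ℓ' :=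
      ((List.prefix_append _ b₂).trans (List.prefix_append _ [T])).trans ha'
    -- If the last writers differed, each would precede the other in one of the lists, although they
    -- conflict on `k`.
    obtain rfl : T₁ = T₂ := by
      by_contra hne
      have hm₁ : T₁ ∈ a₂ := by
        have := h.mem_of_mem hr h' ha ha' (hconf T₁ hw₁) (by simp)
        simp only [List.mem_append, List.mem_singleton] at this
        rcases this with (hm | rfl) | hm
        · exact hm
        · exact absurd rfl hne
        · exact absurd hw₁ (hb₂ _ hm)
      have hm₂ : T₂ ∈ a₁ := by
        have := h'.mem_of_mem hr h ha' ha (hconf T₂ hw₂) (by simp)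
        simp only [List.mem_append, List.mem_singleton] at this
        rcases this with (hm | rfl) | hm
        · exact hm
        · exact absurd rfl hne
        · exact absurd hw₂ (hb₁ _ hm)
      have hc : (L.txn T₁).Conflict (L.txn T₂) := .inl ⟨k, hw₁, .inr hw₂⟩
      have hU₁ := (h _ _ hp₁).1
      have hU₂ := (h' _ _ hp₂).1
      exact hr _ _ (((h _ _ hp₁).2.2 T₂ hU₂ (Ne.symm hne) hc).1 hm₂)
        (((h' _ _ hp₂).2.2 T₁ hU₁ hne hc.symm).1 hm₁)
    -- Nothing after the common last writer touches `k`, and by induction this writer ran on equal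
    -- inputs in both lists.
    rw [run_append_of_notMem L _ _ hb₁, run_append_of_notMem L _ _ hb₂, run_concat, run_concat]
    exact (Transaction.apply_congr
      (ih a₁.length (by simp at hn; omega) hp₁ hp₂ rfl)).2 k hw₁
  · push Not at hex
    have hex' : ∀ T' ∈ a', k ∉ (L.txn T').writeSet := fun T' hm hw =>
      hex T' (h'.mem_of_mem hr h ha' ha (hconf T' hw) hm) hw
    have h1 := run_append_of_notMem L [] a hex
    have h2 := run_append_of_notMem L [] a' hex'
    rw [List.nil_append] at h1 h2
    rw [h1, h2]

end Replay

/-! ### Server logs, the global log and the linearization points. -/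

section Linearization

variable {Client Tx K V R : Type*} [LinearOrder Tx] {f : ℕ}
  {L : Ledger Client Tx K V R} {byz : Finset (Server f)} (ρ : Execution L byz)
  {i j : ℕ} {s s' : Server f} {T T' : Tx}

theorem Step.server_unique {C C' : Config Client Tx K V R f} {e : Option (Event Tx R)}
    (h : Step L byz C e C') (h1 : C'.server s ≠ C.server s) (h2 : C'.server s' ≠ C.server s') :
    s = s' := by
  cases h with
  | deliverClient q c m alive next =>
    unfold Config.clientReceive at h1
    split_ifs at h1 <;> exact absurd rfl h1
  | deliverServer | timeout | learnCommit | learnCancel | applyCommit | applyCancel =>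
    simp only [Config.serverStep, Config.send, Config.consume, Function.update_apply] at h1 h2
    split_ifs at h1 h2 with h3 h4
    · exact h3.trans h4.symm
    all_goals exact absurd rfl (by assumption)
  | _ => exact absurd rfl h1

/-- The consensus instance of `T` decides to commit. -/
def Execution.Commits (T : Tx) : Prop := ∃ i, (ρ.C i).decision T = some .commit

/-- The transactions that are to be committed and have got a timestamp. -/
def Execution.Ordered : Set Tx := {T | ρ.Commits T ∧ ∃ t, ρ.Stamp T t}

theorem Execution.not_commits_of_cancelled (hs : s ∉ byz)
    (h : T ∈ ((ρ.C i).server s).cancelled) : ¬ ρ.Commits T := by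
  rintro ⟨j, hj⟩
  cases ρ.decision_unique hj (ρ.cancelled_decision hs h)

theorem Execution.ordered_of_applicable (hs : s ∉ byz) (h : Applicable L ((ρ.C i).server s) T) :
    T ∈ ρ.Ordered := by
  obtain ⟨-, t, ⟨h1, h2⟩, -⟩ := h
  exact ⟨⟨i, ρ.committed_decision hs h1⟩, t, i, ρ.signed_of_confirmed hs h2⟩

theorem Execution.log_step (hs : s ∉ byz) (i : ℕ) :
    (((ρ.C (i + 1)).server s).log = ((ρ.C i).server s).log ∧
        ((ρ.C (i + 1)).server s).store = ((ρ.C i).server s).store) ∨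
      ∃ T, T ∉ ((ρ.C i).server s).log ∧
        ((ρ.C (i + 1)).server s).log = ((ρ.C i).server s).log ++ [T] ∧
        (Applicable L ((ρ.C i).server s) T ∧ ((ρ.C (i + 1)).server s).store =
            ((L.txn T).apply ((ρ.C i).server s).store).1 ∨
          T ∈ ((ρ.C i).server s).cancelled ∧
            ((ρ.C (i + 1)).server s).store = ((ρ.C i).server s).store) := by
  rcases (ρ.step i).correct hs with ⟨h1, -⟩ | ⟨out, h1, -⟩
  · simp [h1]
  · rcases h1.log_cases with ⟨h2, h3, -⟩ | ⟨T, h2, h3, h4, -⟩ | ⟨T, h2, h3, h4, h5, -⟩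
    · exact .inl ⟨h2, h3⟩
    · exact .inr ⟨T, h2.1, h3, .inl ⟨h2, h4⟩⟩
    · exact .inr ⟨T, h3, h4, .inr ⟨h2, h5⟩⟩

theorem Execution.log_mono (hs : s ∉ byz) (hij : i ≤ j) (h : T ∈ ((ρ.C i).server s).log) :
    T ∈ ((ρ.C j).server s).log := by
  induction j, hij using Nat.le_induction with
  | base => exact h
  | succ j _ ih =>
    rcases ρ.log_step hs j with ⟨h1, -⟩ | ⟨T', -, h1, -⟩ <;> simp [h1, ih]

theorem Execution.new_cases (hs : s ∉ byz) (h : T ∉ ((ρ.C i).server s).log)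
    (h' : T ∈ ((ρ.C (i + 1)).server s).log) :
    ((ρ.C (i + 1)).server s).log = ((ρ.C i).server s).log ++ [T] ∧
      (Applicable L ((ρ.C i).server s) T ∨ T ∈ ((ρ.C i).server s).cancelled) := by
  rcases ρ.log_step hs i with ⟨h1, -⟩ | ⟨T', -, h1, h2⟩
  · exact absurd (h1 ▸ h') h
  · obtain rfl : T = T' := by simpa [h1, h] using h'
    exact ⟨h1, h2.imp And.left And.left⟩

open Classical in
/-- The committed transactions in the log of a server. -/
noncomputable def Execution.committedLog (s : Server f) (i : ℕ) : List Tx :=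
  ((ρ.C i).server s).log.filter fun T => ρ.Commits T

theorem Execution.mem_committedLog :
    T ∈ ρ.committedLog s i ↔ T ∈ ((ρ.C i).server s).log ∧ ρ.Commits T := by
  simp [Execution.committedLog]

/-- Logging a cancelled transaction leaves the store alone, and agreement excludes it from the
filtered log, even though `Commits` refers to the whole execution. -/
theorem Execution.store_eq (hs : s ∉ byz) (i : ℕ) :
    ((ρ.C i).server s).store = run L (ρ.committedLog s i) := by
  induction i with
  | zero => simp [ρ.start, Config.start, ServerState.start, Execution.committedLog, run]
  | succ i ih =>
    unfold Execution.committedLog at *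
    rcases ρ.log_step hs i with ⟨h1, h2⟩ | ⟨T', -, h1, ⟨h2, h3⟩ | ⟨h2, h3⟩⟩
    · rw [h1, h2, ih]
    · rw [h1, h3, List.filter_append, ih, ← run_concat]
      simp [(ρ.ordered_of_applicable hs h2).1]
    · rw [h1, h3, List.filter_append, ih]
      simp [ρ.not_commits_of_cancelled hs h2]

theorem Execution.committedLog_concat (hs : s ∉ byz) (h : Applicable L ((ρ.C i).server s) T)
    (h' : T ∈ ((ρ.C (i + 1)).server s).log) :
    ρ.committedLog s (i + 1) = ρ.committedLog s i ++ [T] := by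
  simp [Execution.committedLog, (ρ.new_cases hs h.1 h').1, (ρ.ordered_of_applicable hs h).1]

/-- The filtered log grows only by applicable transactions, and `before_of_applicable` is the
condition that `Orderly.concat` asks for. -/
theorem Execution.orderly_committedLog (hbyz : byz.card ≤ f) (hs : s ∉ byz) (i : ℕ) :
    Orderly L ρ.Ordered ρ.Before (ρ.committedLog s i) := by
  induction i with
  | zero =>
    simpa [ρ.start, Config.start, ServerState.start, Execution.committedLog] using Orderly.nil
  | succ i ih =>
    rcases ρ.log_step hs i with ⟨h1, -⟩ | ⟨T, h0, h1, ⟨h2, -⟩ | ⟨h2, -⟩⟩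
    · simpa [Execution.committedLog, h1] using ih
    · rw [ρ.committedLog_concat hs h2 (by simp [h1])]
      refine ih.concat (ρ.ordered_of_applicable hs h2) (by simp [ρ.mem_committedLog, h0]) ?_
      rintro T' ⟨hc, t', ht'⟩ hne hconf hn
      obtain ⟨j, hj⟩ := hc
      exact ρ.before_of_applicable hbyz hs h2 hne hconf
        (fun hm => hn (ρ.mem_committedLog.mpr ⟨hm, j, hj⟩)) hj ht'
    · simpa [Execution.committedLog, h1, ρ.not_commits_of_cancelled hs h2] using ih

/-- In step `i`, a correct server logs `T`, which no correct server has done before. -/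
def Execution.FirstLogged (i : ℕ) (T : Tx) : Prop :=
  (∃ s ∉ byz, T ∈ ((ρ.C (i + 1)).server s).log) ∧ ∀ s ∉ byz, T ∉ ((ρ.C i).server s).log

theorem Execution.FirstLogged.unique {ρ : Execution L byz} (h : ρ.FirstLogged i T)
    (h' : ρ.FirstLogged i T') : T = T' := by
  obtain ⟨⟨s, hs, h1⟩, h2⟩ := h
  obtain ⟨⟨s', hs', h1'⟩, h2'⟩ := h'
  obtain rfl : s = s' := by
    refine (ρ.step i).server_unique (fun h => ?_) (fun h => ?_)
    · exact h2 s hs (h ▸ h1)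
    · exact h2' s' hs' (h ▸ h1')
  have h3 := (ρ.new_cases hs (h2 s hs) h1).1
  simpa [h3, h2' s hs, eq_comm] using h1'

open Classical in
/-- The transaction that a correct server logs, as the first one, in step `i`. -/
noncomputable def Execution.first (i : ℕ) : Option Tx :=
  if h : ∃ T, ρ.FirstLogged i T then some h.choose else none

theorem Execution.first_eq_some : ρ.first i = some T ↔ ρ.FirstLogged i T := by
  unfold Execution.first
  constructor
  · intro h
    split_ifs at h with hex
    exact (Option.some_injective _ h) ▸ hex.choose_spec
  · intro h
    have hex : ∃ T, ρ.FirstLogged i T := ⟨T, h⟩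
    rw [dif_pos hex]
    exact congrArg some (hex.choose_spec.unique h)

theorem Execution.exists_first (hs : s ∉ byz) (h : T ∈ ((ρ.C i).server s).log) :
    ∃ j < i, ρ.first j = some T := by
  induction i generalizing s with
  | zero => simp [ρ.start, Config.start, ServerState.start] at h
  | succ i ih =>
    by_cases hex : ∃ s ∉ byz, T ∈ ((ρ.C i).server s).log
    · obtain ⟨s', hs', h'⟩ := hex
      obtain ⟨j, hj, h⟩ := ih hs' h'
      exact ⟨j, by omega, h⟩
    · push Not at hex
      exact ⟨i, by omega, ρ.first_eq_some.mpr ⟨⟨s, hs, h⟩, hex⟩⟩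

theorem Execution.first_unique (h : ρ.first i = some T) (h' : ρ.first j = some T) : i = j := by
  wlog hij : i < j generalizing i j
  · rcases lt_trichotomy i j with h1 | h1 | h1
    · exact this h h' h1
    · exact h1
    · exact (this h' h h1).symm
  obtain ⟨⟨s, hs, h1⟩, -⟩ := ρ.first_eq_some.mp h
  exact absurd (ρ.log_mono hs hij h1) ((ρ.first_eq_some.mp h').2 s hs)

open Classical in
/-- The transactions committed in the first `i` steps, in the order in which they are first
applied by correct servers. -/
noncomputable def Execution.globalLog : ℕ → List Tx
  | 0 => []
  | i + 1 => globalLog i ++ (ρ.first i).toList.filter fun T => ρ.Commits T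

theorem Execution.mem_globalLog :
    T ∈ ρ.globalLog i ↔ ρ.Commits T ∧ ∃ s ∉ byz, T ∈ ((ρ.C i).server s).log := by
  induction i with
  | zero => simp [Execution.globalLog, ρ.start, Config.start, ServerState.start]
  | succ i ih =>
    simp only [Execution.globalLog, List.mem_append, ih, List.mem_filter, Option.mem_toList,
      ρ.first_eq_some, decide_eq_true_eq]
    constructor
    · rintro (⟨h1, s, hs, h2⟩ | ⟨h1, h2⟩)
      · exact ⟨h1, s, hs, ρ.log_mono hs (Nat.le_succ i) h2⟩
      · exact ⟨h2, h1.1⟩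
    · rintro ⟨h1, h2⟩
      by_cases hex : ∃ s ∉ byz, T ∈ ((ρ.C i).server s).log
      · exact .inl ⟨h1, hex⟩
      · push Not at hex
        exact .inr ⟨⟨h2, hex⟩, h1⟩

theorem Execution.globalLog_concat (h : ρ.first i = some T) (hc : ρ.Commits T) :
    ρ.globalLog (i + 1) = ρ.globalLog i ++ [T] := by
  simp [Execution.globalLog, h, hc]

/-- A committed transaction missing from the global log is missing from every correct log, in
particular from that of the server that logs `T` first. That server's own test therefore suffices.
-/
theorem Execution.orderly_globalLog (hbyz : byz.card ≤ f) (i : ℕ) :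
    Orderly L ρ.Ordered ρ.Before (ρ.globalLog i) := by
  induction i with
  | zero => exact Orderly.nil
  | succ i ih =>
    by_cases hex : ∃ T, ρ.first i = some T ∧ ρ.Commits T
    · obtain ⟨T, h, hc⟩ := hex
      rw [ρ.globalLog_concat h hc]
      obtain ⟨⟨s, hs, h1⟩, h2⟩ := ρ.first_eq_some.mp h
      have happ := (ρ.new_cases hs (h2 s hs) h1).2.resolve_right fun hcan =>
        ρ.not_commits_of_cancelled hs hcan hc
      refine ih.concat (ρ.ordered_of_applicable hs happ) ?_ ?_
      · rw [ρ.mem_globalLog]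
        rintro ⟨-, s', hs', h'⟩
        exact h2 s' hs' h'
      · rintro T' ⟨hc', t', ht'⟩ hne hconf hn
        obtain ⟨j, hj⟩ := hc'
        exact ρ.before_of_applicable hbyz hs happ hne hconf
          (fun hm => hn (ρ.mem_globalLog.mpr ⟨⟨j, hj⟩, s, hs, hm⟩)) hj ht'
    · push Not at hex
      have : ρ.globalLog (i + 1) = ρ.globalLog i := by
        cases h : ρ.first i with
        | none => simp [Execution.globalLog, h]
        | some T => simp [Execution.globalLog, h, hex T h]
      rwa [this]

open Classical in
/-- The linearization: a transaction takes effect when the first correct server logs it. -/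
noncomputable def Execution.linearization (i : ℕ) : Option (Tx × Option R) :=
  (ρ.first i).map fun T =>
    (T, if ρ.Commits T then some ((L.txn T).apply (run L (ρ.globalLog i))).2 else none)

theorem Execution.first_of_linearization {r : Option R} (h : ρ.linearization i = some (T, r)) :
    ρ.first i = some T := by
  unfold Execution.linearization at h
  cases hf : ρ.first i <;> simp_all

theorem Execution.ack_cases (hs : s ∉ byz) {b : Node Client f} {code : Code} {r : Option R}
    (h : .resolveAck T code r ∈ (ρ.C i).sent (.server s) b) :
    ∃ j < i, T ∈ ((ρ.C (j + 1)).server s).log ∧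
      (Applicable L ((ρ.C j).server s) T ∧ code = .commit ∧
          r = some ((L.txn T).apply ((ρ.C j).server s).store).2 ∨
        T ∈ ((ρ.C j).server s).cancelled ∧ code = .cancel ∧ r = none) := by
  induction i with
  | zero => simp [ρ.start, Config.start] at h
  | succ i ih =>
    have hold : .resolveAck T code r ∈ (ρ.C i).sent (.server s) b → ∃ j < i + 1, _ := fun h => by
      obtain ⟨j, hj, h⟩ := ih h
      exact ⟨j, Nat.lt_succ_of_lt hj, h⟩
    rcases (ρ.step i).correct hs with ⟨-, h2⟩ | ⟨out, h1, h2⟩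
    · exact hold (h2 b ▸ h)
    · rw [h2] at h
      rcases List.mem_append.mp h with h | h
      · exact hold h
      · refine ⟨i, Nat.lt_succ_self i, ?_⟩
        rcases h1.log_cases with ⟨-, -, h3⟩ | ⟨T', h3, h4, -, h5⟩ | ⟨T', h3, -, h4, -, h5⟩
        · exact absurd h (h3 _ _ _ _)
        · obtain ⟨rfl, h6⟩ := h5 _ _ _ _ h
          exact ⟨by simp [h4], .inl ⟨h3, h6⟩⟩
        · obtain ⟨rfl, h6⟩ := h5 _ _ _ _ h
          exact ⟨by simp [h4], .inr ⟨h3, h6⟩⟩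

/-- The server may execute `T` later than its linearization point and on a different store. Both
prefixes are followed by `T` in orderly lists, so `run_eq` makes the results equal. -/
theorem Execution.linearization_of_ack (hbyz : byz.card ≤ f) (hs : s ∉ byz) {b : Node Client f}
    {code : Code} {r : Option R} (h : .resolveAck T code r ∈ (ρ.C i).sent (.server s) b) :
    ∃ j < i, ρ.linearization j = some (T, answer code r) := by
  obtain ⟨l, hl, hlog, h⟩ := ρ.ack_cases hs h
  obtain ⟨j, hj, hf⟩ := ρ.exists_first hs hlog
  refine ⟨j, by omega, ?_⟩
  rcases h with ⟨happ, rfl, rfl⟩ | ⟨hcan, rfl, rfl⟩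
  · have hc := (ρ.ordered_of_applicable hs happ).1
    have h1 := ρ.orderly_committedLog hbyz hs (l + 1)
    have h2 := ρ.orderly_globalLog hbyz (j + 1)
    have hrun := h2.run_eq (a := ρ.globalLog j) (a' := ρ.committedLog s l)
      (fun _ _ h => Execution.Before.asymm h) h1
      (by rw [ρ.globalLog_concat hf hc])
      (by rw [ρ.committedLog_concat hs happ hlog])
    simp only [Execution.linearization, hf, Option.map_some, if_pos hc, answer, ρ.store_eq hs,
      (Transaction.apply_congr hrun).1]
  · simp [Execution.linearization, hf, ρ.not_commits_of_cancelled hs hcan, answer]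

theorem Execution.isLinearization (hbyz : byz.card ≤ f) :
    IsLinearization L ρ.ev ρ.linearization where
  once i j T r r' h h' :=
    ρ.first_unique (ρ.first_of_linearization h) (ρ.first_of_linearization h')
  after_inv i T r h := by
    obtain ⟨⟨s, hs, h1⟩, h2⟩ := ρ.first_eq_some.mp (ρ.first_of_linearization h)
    apply ρ.invoked
    -- An applied transaction was confirmed by its client. For a cancelled one, consensus validity
    -- gives a correct server that proposed CANCEL.
    rcases (ρ.new_cases hs (h2 s hs) h1).2 with ⟨-, t, ⟨-, hc⟩, -⟩ | hc
    · obtain ⟨q, hq⟩ := ρ.signed_of_confirmed hs hc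
      exact (ρ.chosen_of_confirm hq).2.2.1
    · obtain ⟨q, hq, hr⟩ := ρ.decision_resolving (ρ.cancelled_decision hs hc)
      exact ρ.started_of_resolving hbyz hq hr
  before_res k T r h := by
    obtain ⟨code, x, rfl, A, hA, hrec⟩ := (h ▸ ρ.step k).respond_eq
    obtain ⟨q, hq, hqb⟩ := Finset.exists_mem_notMem_of_card_lt_card
      (hbyz.trans_lt (Nat.lt_of_succ_le hA))
    exact ρ.linearization_of_ack hbyz hqb (ρ.received_sent (hrec q hq))
  legal := by
    -- Cancelled transactions are dropped from `globalLog`, so this state does not move at their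
    -- linearization points.
    refine ⟨fun i => run L (ρ.globalLog i), rfl, fun i h => ?_, fun i T r h => ?_⟩
    · have : ρ.first i = none := by simpa [Execution.linearization] using h
      simp [Execution.globalLog, this]
    · have hf := ρ.first_of_linearization h
      by_cases hc : ρ.Commits T
      · simp only [Execution.linearization, hf, hc, if_true, Option.map_some, Option.some.injEq,
          Prod.mk.injEq, true_and] at h
        subst h
        simp only [SeqStep, ρ.globalLog_concat hf hc, run_concat]
      · simp only [Execution.linearization, hf, hc, if_false, Option.map_some, Option.some.injEq,
          Prod.mk.injEq, true_and] at h
        subst h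
        simp [SeqStep, Execution.globalLog, hf, hc]

/-! ### Agreement between correct servers. -/

theorem Execution.resolveAck_unique (hbyz : byz.card ≤ f) (hs : s ∉ byz) (hs' : s' ∉ byz)
    {b b' : Node Client f} {code code' : Code} {r r' : Option R}
    (h : .resolveAck T code r ∈ (ρ.C i).sent (.server s) b)
    (h' : .resolveAck T code' r' ∈ (ρ.C j).sent (.server s') b') : code = code' ∧ r = r' := by
  obtain ⟨k, -, hk⟩ := ρ.linearization_of_ack hbyz hs h
  obtain ⟨k', -, hk'⟩ := ρ.linearization_of_ack hbyz hs' h'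
  obtain rfl := (ρ.isLinearization hbyz).once _ _ _ _ _ hk hk'
  have heq : answer code r = answer code' r' := by simpa [hk] using hk'
  -- Equal answers alone do not give equal codes, as `answer .commit none` is also `none`. Commit
  -- acknowledgements of correct servers always carry `some` result.
  obtain ⟨_, -, -, ⟨-, rfl, rfl⟩ | ⟨-, rfl, rfl⟩⟩ := ρ.ack_cases hs h <;>
    obtain ⟨_, -, -, ⟨-, rfl, rfl⟩ | ⟨-, rfl, rfl⟩⟩ := ρ.ack_cases hs' h' <;>
    simp_all [answer]

theorem Execution.not_cancelled_of_committed (hs : s ∉ byz) (hs' : s' ∉ byz)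
    (h : T ∈ ((ρ.C i).server s).committed) : T ∉ ((ρ.C j).server s').cancelled := fun h' =>
  ρ.not_commits_of_cancelled hs' h' ⟨i, ρ.committed_decision hs h⟩

theorem Execution.Fair.committed {ρ : Execution L byz} (hρ : ρ.Fair) (hs : s ∉ byz)
    (hs' : s' ∉ byz) (h : T ∈ ((ρ.C i).server s).committed) :
    ∃ j, T ∈ ((ρ.C j).server s').committed := by
  have hres : ∀ q, q ∉ byz → ∃ j, ((ρ.C j).server q).resolving T ≠ none := by
    intro q hq
    -- The server that committed `T` need not have announced COMMIT itself; consensus validity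
    -- supplies a correct `s₀` that did.
    obtain ⟨s₀, hs₀, hr⟩ := ρ.decision_resolving (ρ.committed_decision hs h)
    obtain ⟨t, ht⟩ := ρ.resolving_sent hs₀ hr
    obtain ⟨p, hp, hm⟩ := List.mem_iff_getElem.mp (ht q)
    obtain ⟨j, hj⟩ := hρ.delivery (.server s₀) q (by rintro _ ⟨⟩; exact hs₀) hq i p hp
    refine ⟨max i j, ρ.resolving_of_delivered hq (q := s₀) (p := p) (t := t) ⟨?_, ?_⟩⟩
    · exact hj.trans_le (ρ.rcvd_mono (le_max_right i j) _ _)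
    · obtain ⟨l, hl⟩ := ρ.sent_prefix (le_max_left i j) (.server s₀) (.server q)
      rw [← hl, List.getElem?_append_left hp]
      exact List.getElem?_eq_some_iff.mpr ⟨hp, hm⟩
  obtain ⟨j, hj⟩ := hρ.consensus T hres ⟨s, hs, i, .inl h⟩ s' hs'
  exact ⟨j, hj.resolve_right (ρ.not_cancelled_of_committed hs hs' h)⟩

end Linearization

end Byblos

theorem mainTheorem1 {Client Tx K V R : Type*} [LinearOrder Tx] {f : ℕ}
    (L : Byblos.Ledger Client Tx K V R) (byz : Finset (Byblos.Server f)) (hbyz : byz.card ≤ f)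
    (ρ : Byblos.Execution L byz) :
    -- the execution is linearizable, consistently with the responses of the correct servers
    (∃ lin : ℕ → Option (Tx × Option R), Byblos.IsLinearization L ρ.ev lin ∧
      ∀ s, s ∉ byz → ∀ i T code r,
        Byblos.Msg.resolveAck T code r ∈ (ρ.C i).sent (.server s) (.client (L.owner T)) →
          ∃ j < i, lin j = some (T, Byblos.answer code r)) ∧
    -- correct servers return the same responses
    (∀ s s', s ∉ byz → s' ∉ byz → ∀ i j T code code' r r',
      Byblos.Msg.resolveAck T code r ∈ (ρ.C i).sent (.server s) (.client (L.owner T)) →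
      Byblos.Msg.resolveAck T code' r' ∈ (ρ.C j).sent (.server s') (.client (L.owner T)) →
        code = code' ∧ r = r') ∧
    -- no transaction is committed by one correct server and cancelled by another
    (∀ s s', s ∉ byz → s' ∉ byz → ∀ i j T,
      T ∈ ((ρ.C i).server s).committed → T ∉ ((ρ.C j).server s').cancelled) ∧
    -- correct servers commit the same set of transactions
    (ρ.Fair → ∀ s s', s ∉ byz → s' ∉ byz →
      (⋃ i, ((ρ.C i).server s).committed) = ⋃ i, ((ρ.C i).server s').committed) := by
  refine ⟨⟨ρ.linearization, ρ.isLinearization hbyz, fun s hs i T code r h =>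
      ρ.linearization_of_ack hbyz hs h⟩,
    fun s s' hs hs' i j T code code' r r' h h' => ρ.resolveAck_unique hbyz hs hs' h h',
    fun s s' hs hs' i j T h => ρ.not_cancelled_of_committed hs hs' h,
    fun hρ s s' hs hs' => Set.ext fun T => ?_⟩
  simp only [Set.mem_iUnion]
  exact ⟨fun ⟨_, h⟩ => hρ.committed hs hs' h, fun ⟨_, h⟩ => hρ.committed hs' hs h⟩
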